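/- **Notation.** Let $n\ge 0$, $I=[-1,1]$. A sub-cube of the $n$-cube is a word $x\in\{-,0,+\}^n$; it stands for the geometric sub-cube of $I^n$ whose $i$-th factor is $\{-1\}$, $I$ or $\{1\}$ according to $x_i=-,0,+$. Its dimension $|x|$ is the number of its symbols $0$; two sub-cubes are parallel if their $0$'s are in the same positions. The antipodal map $x\mapsto -x$ interchanges $-$ and $+$ (on $I^n$: $p\mapsto -p$). For $|x|=p$ and $y\in\{-,0,+\}^p$, $x*y$ is obtained from $x$ by writing $y$, in order, over the $p$ symbols $0$ of $x$. Let $\lambda,\mu,\nu$ add $-,0,+$ respectively at the right end of a word. The source and target faces $\psi_k[n],\omega_k[n]$ are the sets of sub-cubes with $\psi_k[n]=\omega_k[n]=\{0\cdots0\}$ for $k\ge n$; $\psi_0[n]=\{-\cdots-\}$ and $\omega_0[n]=\{+\cdots+\}$; and, for $1\le k<n$, $$\psi_k[n]=\mu\psi_{k-1}[n-1]\cup\lambda\psi_k[n-1],\quad \omega_k[n]=\nu\omega_k[n-1]\cup\mu\omega_{k-1}[n-1]\quad(k\text{ even}),$$ $$\psi_k[n]=\mu\psi_{k-1}[n-1]\cup\nu\psi_k[n-1],\quad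 \omega_k[n]=\lambda\omega_k[n-1]\cup\mu\omega_{k-1}[n-1]\quad(k\text{ odd}).$$ An $(n,n)$-pile is a sequence $\Pi=(v_0,\dots,v_n)$ where $v_k$ is a set of $\binom nk$ sub-cubes of the $n$-cube, all of dimension $k$. A $k$-section is a set of $k$-dimensional sub-cubes containing exactly one representative of each class of parallel $k$-dimensional sub-cubes. Call $\Pi$ a *disk pile* if for every $k$ the set $v_k$ is a $k$-section whose union $|v_k|\subset I^n$ is a $k$-dimensional disk (homeomorphic to the closed $k$-ball, its boundary corresponding to the sphere) with boundary invariant under the antipodal map. Here the boundary of $|v_k|$ is the union of the $(k-1)$-dimensional sub-cubes that are faces of an odd number (for a disk: of exactly one) of the elements of $v_k$. *Operations.* For $j\ge0$, $*_j(\Pi)$ is obtained from $\Pi$ by applying the antipodal map to every element of $v_i$ for all $i\le j-1$. For a sub-cube $x$ with $|x|=p$, the move $\pi_x$ is defined on $\Pi$ if $x*\psi_i[p]\subset v_i$ for all $i\le p$; then $\pi_x(\Pi)$ is obtained by replacing, for each $i\le p$, the subset $x*\psi_i[p]$ of $v_i$ by $x*\omega_i[p]$. **Proposition 4.10.** Let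 $\Pi_0$ be an $(n,n)$-pile that is a disk pile. Then $*_j(\Pi_0)$ is an $(n,n)$-pile and a disk pile for every $j$, and $\pi_x(\Pi_0)$ is an $(n,n)$-pile and a disk pile for every sub-cube $x$ for which $\pi_x$ is defined on $\Pi_0$. Moreover, in each case and for each $k$, the disk given by the $k$-th set of the new pile has the same boundary as the disk $|v_k|$ of $\Pi_0$. -/

import Mathlib

namespace CubePile

/-- Sub-cubes of the `n`-cube: words of length `n` in the symbols `-`, `0`, `+`.
`Pi` negation is the antipodal map, exchanging `-` and `+`. -/
abbrev Cube (n : ℕ) : Type := Fin n → SignType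

/-- The positions of the symbol `0` in a word; they determine its parallel set. -/
def zeros {n : ℕ} (x : Cube n) : Finset (Fin n) := Finset.univ.filter fun i => x i = 0

/-- The dimension `|x|`: the number of symbols `0`. -/
def dim {n : ℕ} (x : Cube n) : ℕ := (zeros x).card

/-- `x * y`: the word `y`, of length `|x|`, is written, in increasing order of the
positions, over the symbols `0` of `x`. -/
def place {n : ℕ} (x : Cube n) (y : Cube (dim x)) : Cube n := fun i =>
  if h : x i = 0 then
    y (((zeros x).orderIsoOfFin rfl).symm ⟨i, by simp [zeros, h]⟩)
  else x i

/-- Add the symbol `s` to the right of a word: `s = -1, 0, 1` gives `λ, μ, ν`. -/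
def extend {n : ℕ} (s : SignType) (x : Cube n) : Cube (n + 1) :=
  Fin.snoc (α := fun _ => SignType) x s

/-- The source `k`-faces `ψ_k[n]` of the `n`-cube. -/
def sourceFaces : (n k : ℕ) → Finset (Cube n)
  | 0, _ => {0}
  | _ + 1, 0 => {fun _ => -1}
  | n + 1, k + 1 =>
    if n + 1 ≤ k + 1 then {0}
    else if Even (k + 1) then
      (sourceFaces n k).image (extend 0) ∪ (sourceFaces n (k + 1)).image (extend (-1))
    else
      (sourceFaces n k).image (extend 0) ∪ (sourceFaces n (k + 1)).image (extend 1)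

/-- The target `k`-faces `ω_k[n]` of the `n`-cube. -/
def targetFaces : (n k : ℕ) → Finset (Cube n)
  | 0, _ => {0}
  | _ + 1, 0 => {fun _ => 1}
  | n + 1, k + 1 =>
    if n + 1 ≤ k + 1 then {0}
    else if Even (k + 1) then
      (targetFaces n (k + 1)).image (extend 1) ∪ (targetFaces n k).image (extend 0)
    else
      (targetFaces n (k + 1)).image (extend (-1)) ∪ (targetFaces n k).image (extend 0)

/-- The source `j`-faces of the sub-cube `x`: the `j`-th set of the pile `Ψ_x`. -/
def sourceOf {n : ℕ} (x : Cube n) (j : ℕ) : Finset (Cube n) :=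
  (sourceFaces (dim x) j).image (place x)

/-- The target `j`-faces of the sub-cube `x`: the `j`-th set of the pile `Ω_x`. -/
def targetOf {n : ℕ} (x : Cube n) (j : ℕ) : Finset (Cube n) :=
  (targetFaces (dim x) j).image (place x)

/-- A sequence `v_0, …, v_m` of sets of sub-cubes of the `n`-cube. -/
abbrev CubeSeq (m n : ℕ) : Type := Fin (m + 1) → Finset (Cube n)

/-- `v` is an `(m, n)`-pile. -/
def IsPile {m n : ℕ} (v : CubeSeq m n) : Prop :=
  ∀ j : Fin (m + 1), (v j).card = m.choose j ∧ ∀ x ∈ v j, dim x = j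

/-- `v` is a `k`-section: exactly one representative of each parallel set of
`k`-dimensional sub-cubes. -/
def IsSection {n : ℕ} (k : ℕ) (v : Finset (Cube n)) : Prop :=
  (∀ x ∈ v, dim x = k) ∧
    ∀ S : Finset (Fin n), S.card = k → ∃! x : Cube n, x ∈ v ∧ zeros x = S

/-- The geometric sub-cube of `[-1, 1]^n` given by a word. -/
def realize {n : ℕ} (x : Cube n) : Set (Fin n → ℝ) :=
  {p | ∀ i, if x i = 0 then p i ∈ Set.Icc (-1 : ℝ) 1 else p i = (x i : ℝ)}

/-- The topological union of a set of sub-cubes. Two sub-cubes of `[-1, 1]^n` that meet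
do so in a common face, so in this union they are identified along common faces. -/
def support {n : ℕ} (v : Finset (Cube n)) : Set (Fin n → ℝ) := ⋃ x ∈ v, realize x

/-- `y` is a face of `x` of one dimension less. -/
def IsFacet {n : ℕ} (y x : Cube n) : Prop :=
  (∀ i, x i ≠ 0 → y i = x i) ∧ dim y + 1 = dim x

instance {n : ℕ} (y x : Cube n) : Decidable (IsFacet y x) :=
  inferInstanceAs (Decidable (_ ∧ _))

/-- The cellular (mod 2) boundary of a set of `k`-dimensional sub-cubes: the
`(k - 1)`-dimensional sub-cubes that are facets of an odd number of them. If the union is a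
`k`-dimensional disk, a `(k - 1)`-cube is a facet of at most two of the `k`-cubes, so that
these are the facets of exactly one of them. -/
def cellBoundary {n : ℕ} (v : Finset (Cube n)) : Finset (Cube n) :=
  Finset.univ.filter fun y => Odd (v.filter fun x => IsFacet y x).card

/-- The boundary of the union of a set of sub-cubes, as a set of points. -/
def boundary {n : ℕ} (v : Finset (Cube n)) : Set (Fin n → ℝ) := support (cellBoundary v)

/-- The union of the `k`-cubes in `v` is a `k`-dimensional disk: it is homeomorphic to the
closed unit ball of `ℝ^k`, the boundary corresponding to the unit sphere. (That the
boundary corresponds to the sphere holds for every homeomorphism with the ball, by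
invariance of domain.) -/
def IsDisk {n : ℕ} (k : ℕ) (v : Finset (Cube n)) : Prop :=
  ∃ h : Metric.closedBall (0 : EuclideanSpace ℝ (Fin k)) 1 ≃ₜ support v,
    ∀ p, (h p : Fin n → ℝ) ∈ boundary v ↔
      (p : EuclideanSpace ℝ (Fin k)) ∈ Metric.sphere (0 : EuclideanSpace ℝ (Fin k)) 1

/-- An `(n, n)`-pile each of whose sets `v_k` is a `k`-section whose union is a disk with
boundary invariant under the antipodal map. -/
def IsDiskPile {n : ℕ} (v : CubeSeq n n) : Prop :=
  IsPile v ∧ ∀ k : Fin (n + 1),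
    IsSection k (v k) ∧ IsDisk k (v k) ∧ ∀ p ∈ boundary (v k), -p ∈ boundary (v k)

/-- The operation `*_j`: apply the antipodal map to all elements of `v_i`, `i ≤ j - 1`. -/
def antipodeBelow {n : ℕ} (j : ℕ) (v : CubeSeq n n) : CubeSeq n n := fun i =>
  if (i : ℕ) < j then (v i).image (fun x => -x) else v i

/-- `π_x` is defined on `v`: the pile `Ψ_x` embeds into `v`. -/
def MoveDefined {n : ℕ} (x : Cube n) (v : CubeSeq n n) : Prop :=
  ∀ j : Fin (n + 1), (j : ℕ) ≤ dim x → sourceOf x j ⊆ v j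

/-- The pile move `π_x`: replace `Ψ_x` by `Ω_x`. -/
def move {n : ℕ} (x : Cube n) (v : CubeSeq n n) : CubeSeq n n := fun j =>
  if (j : ℕ) ≤ dim x then (v j \ sourceOf x j) ∪ targetOf x j else v j

end CubePile

open CubePile

/-! The antipodal map is a homeomorphism of the cube that keeps parallel classes, so only the moves
`π_x` need an argument. In each dimension `k < |x|` a move splits into flips: the `k`-facets of a
`(k+1)`-cube `z` through a vertex `w` are exchanged for those through the opposite vertex. By
induction on the recursive definition of the faces, `ψ_k` is swept to `ω_k` by flips through the
cubes of `ψ_{k+1}` (`sweep_sourceFaces`); `place` carries this sweep into `x`. For `k = |x|` nothing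
changes.

A flip exchanges parallel cubes, so it keeps sections; all facets of `z` together form a mod 2
cycle, so it keeps the boundary (`cellBoundary_flip`). For disks, pushing along the diagonal of `z`
carries one star onto the other and fixes their common frontier. It extends by the identity over the
rest of `|v|` as soon as the rest meets either star only in that frontier (`IsDisk.flip`).

This last point is the crux. As the boundary of `v` is antipodally invariant, `v ∪ -v` is a mod 2
cycle, with only one antipodal pair in each parallel class. Such cycles stay cycles when coordinates
are deleted (`even_card_cofaceDirections`). Suppose that a cube `c` of the cycle has a direction `s`
not in `z`, and that in the directions of `z` its symbols are `0` or agree with `w`. After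
projection to the directions of `z` and `s`, some face would have exactly three cofaces, against
parity (`not_le_vertex_of_vertexStar_subset`). Applied to `c` and to `-c`, this shows that every
cube of `v` outside the star has, among the directions of `z`, both a symbol opposite to `w` and a
symbol equal to `w`. -/

namespace CubePile

variable {n : ℕ}

/-! ### Words, facets and the mod 2 boundary -/

@[simp] lemma mem_zeros {x : Cube n} {i : Fin n} : i ∈ zeros x ↔ x i = 0 := by
  simp [zeros]

@[simp] lemma zeros_neg (x : Cube n) : zeros (-x) = zeros x := by
  ext i
  simp only [mem_zeros, Pi.neg_apply]
  cases x i <;> decide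

@[simp] lemma dim_neg (x : Cube n) : dim (-x) = dim x := by simp [dim]

lemma sign_ne_zero_iff {a : SignType} : a ≠ 0 ↔ a = 1 ∨ a = -1 := by
  cases a <;> decide

lemma sign_eq_or_eq_neg {a b : SignType} (ha : a ≠ 0) (hb : b ≠ 0) : a = b ∨ a = -b := by
  revert a b; decide

lemma sign_ne_neg_self {a : SignType} (ha : a ≠ 0) : a ≠ -a := by
  revert a; decide

lemma sign_neg_ne_zero {a : SignType} (ha : a ≠ 0) : -a ≠ 0 := by
  revert a; decide

/-- Every facet arises from its cube by giving a sign to one of the symbols `0`. -/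
lemma isFacet_iff {y x : Cube n} :
    IsFacet y x ↔ ∃ j, y j ≠ 0 ∧ x = Function.update y j 0 := by
  constructor
  · rintro ⟨h, hd⟩
    have hsub : zeros y ⊆ zeros x := by
      intro i hi
      by_contra hx
      rw [mem_zeros] at hi hx
      exact hx ((h i hx).symm.trans hi)
    have hc : (zeros x \ zeros y).card = 1 := by
      rw [Finset.card_sdiff_of_subset hsub]; unfold dim at hd; omega
    obtain ⟨j, hj⟩ := Finset.card_eq_one.1 hc
    have hj' : ∀ i, (x i = 0 ∧ y i ≠ 0) ↔ i = j := by
      intro i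
      have := congrArg (i ∈ ·) hj
      simpa using this
    refine ⟨j, ((hj' j).2 rfl).2, ?_⟩
    ext i : 1
    by_cases hi : i = j
    · subst hi; simpa using ((hj' i).2 rfl).1
    · rw [Function.update_of_ne hi]
      by_cases hx : x i = 0
      · by_contra hne
        exact hi ((hj' i).1 ⟨hx, fun h0 => hne (hx.trans h0.symm)⟩)
      · exact (h i hx).symm
  · rintro ⟨j, hj, rfl⟩
    have hz : zeros (Function.update y j 0) = insert j (zeros y) := by
      ext i
      by_cases hi : i = j
      · subst hi; simp
      · simp [hi]
    refine ⟨fun i hi => ?_, ?_⟩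
    · by_cases hij : i = j
      · subst hij; simp at hi
      · simp [hij]
    · unfold dim
      rw [hz, Finset.card_insert_of_notMem (by simpa using hj)]

lemma zeros_update_zero (y : Cube n) (j : Fin n) :
    zeros (Function.update y j 0) = insert j (zeros y) := by
  ext i
  by_cases hi : i = j
  · subst hi; simp
  · simp [hi]

lemma zeros_update_of_ne_zero (y : Cube n) (j : Fin n) {a : SignType} (ha : a ≠ 0) :
    zeros (Function.update y j a) = (zeros y).erase j := by
  ext i
  by_cases hi : i = j
  · subst hi; simp [ha]
  · simp [hi]

lemma isFacet_neg {y x : Cube n} : IsFacet (-y) (-x) ↔ IsFacet y x := by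
  simp only [IsFacet, dim_neg, Pi.neg_apply, neg_inj, ne_eq]
  refine and_congr_left fun _ => forall_congr' fun i => ?_
  cases x i <;> simp

lemma mem_image_neg {v : Finset (Cube n)} {x : Cube n} :
    x ∈ v.image (fun x => -x) ↔ -x ∈ v := by
  simp only [Finset.mem_image]
  exact ⟨by rintro ⟨a, ha, rfl⟩; simpa, fun h => ⟨-x, h, neg_neg x⟩⟩

lemma mem_cellBoundary {v : Finset (Cube n)} {y : Cube n} :
    y ∈ cellBoundary v ↔ Odd (v.filter fun x => IsFacet y x).card := by
  simp [cellBoundary]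

lemma mem_cellBoundary_image_neg {v : Finset (Cube n)} {y : Cube n} :
    y ∈ cellBoundary (v.image fun x => -x) ↔ -y ∈ cellBoundary v := by
  rw [mem_cellBoundary, mem_cellBoundary]
  have : ((v.image fun x => -x).filter fun x => IsFacet y x)
      = (v.filter fun x => IsFacet (-y) x).image fun x => -x := by
    ext x
    simp only [Finset.mem_filter, mem_image_neg]
    rw [isFacet_neg]
  rw [this, Finset.card_image_of_injective _ neg_injective]

lemma exists_isFacet_of_mem_cellBoundary {v : Finset (Cube n)} {y : Cube n}
    (h : y ∈ cellBoundary v) : ∃ x ∈ v, IsFacet y x := by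
  rw [mem_cellBoundary] at h
  obtain ⟨x, hx⟩ := Finset.card_pos.1 h.pos
  exact ⟨x, by simpa using hx⟩

/-! ### Projections of antipodal cycles -/

/-- Words in which the symbols `0` are at given positions form at most one antipodal pair. -/
def IsAntipodalSection (k : ℕ) (Z : Finset (Cube n)) : Prop :=
  ∀ a ∈ Z, dim a = k ∧ ∀ b ∈ Z, zeros a = zeros b → a = b ∨ a = -b

/-- The directions `j` in which the word `y`, after deletion of the positions in `D`, has a
coface among the words of `Z` not vanishing on `D`. -/
noncomputable def cofaceDirections (Z : Finset (Cube n)) (D : Finset (Fin n)) (y : Cube n) :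
    Finset (Fin n) :=
  open Classical in Finset.univ.filter fun j => j ∉ D ∧ y j ≠ 0 ∧
    ∃ c ∈ Z, zeros c = insert j (zeros y) ∧ ∀ i, i ∉ D → i ∉ insert j (zeros y) → c i = y i

lemma mem_cofaceDirections {Z : Finset (Cube n)} {D : Finset (Fin n)} {y : Cube n} {j : Fin n} :
    j ∈ cofaceDirections Z D y ↔ j ∉ D ∧ y j ≠ 0 ∧
    ∃ c ∈ Z, zeros c = insert j (zeros y) ∧
      ∀ i, i ∉ D → i ∉ insert j (zeros y) → c i = y i := by
  simp [cofaceDirections]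

lemma card_cofaceDirections_empty (Z : Finset (Cube n)) (y : Cube n) :
    (cofaceDirections Z ∅ y).card = (Z.filter fun x => IsFacet y x).card := by
  refine Finset.card_bij (fun j _ => Function.update y j 0) ?_ ?_ ?_
  · intro j hj
    obtain ⟨-, hj0, c, hc, hz, h⟩ := mem_cofaceDirections.1 hj
    have : c = Function.update y j 0 := by
      ext i : 1
      by_cases hi : i ∈ insert j (zeros y)
      · have h0 : i ∈ zeros c := hz ▸ hi
        have h1 : i ∈ zeros (Function.update y j 0) := zeros_update_zero y j ▸ hi
        rw [mem_zeros.1 h0, mem_zeros.1 h1]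
      · rw [h i (by simp) hi, Function.update_of_ne (by rintro rfl; simp at hi)]
    rw [Finset.mem_filter, isFacet_iff]
    exact ⟨this ▸ hc, j, hj0, rfl⟩
  · intro i hi j hj h
    by_contra hne
    have h1 := congrFun h i
    simp [Function.update_of_ne hne] at h1
    exact (mem_cofaceDirections.1 hi).2.1 h1.symm
  · intro x hx
    obtain ⟨hxZ, hx⟩ := Finset.mem_filter.1 hx
    obtain ⟨j, hj, rfl⟩ := isFacet_iff.1 hx
    refine ⟨j, mem_cofaceDirections.2 ⟨by simp, hj, _, hxZ, zeros_update_zero y j, ?_⟩, rfl⟩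
    intro i _ hi
    rw [Function.update_of_ne (by rintro rfl; simp at hi)]

/-- A coface that survives the deletion of `u` has a definite sign at `u`, so it comes from one of
the two lifts of `y`. A coface in the direction `u` itself does not see the sign of `y` at `u`,
hence is shared by both lifts and cancels mod 2. -/
lemma cofaceDirections_insert {k : ℕ} {Z : Finset (Cube n)} (hZ : IsAntipodalSection k Z)
    {D : Finset (Fin n)} {u : Fin n} (huD : u ∉ D) (hD : D.card + 1 + k < n)
    {y : Cube n} (hy : (zeros y).card + 1 = k) (hyu : y u ≠ 0) :
    cofaceDirections Z (insert u D) y =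
        (cofaceDirections Z D (Function.update y u 1)).erase u ∪
        (cofaceDirections Z D (Function.update y u (-1))).erase u ∧
    Disjoint ((cofaceDirections Z D (Function.update y u 1)).erase u)
      ((cofaceDirections Z D (Function.update y u (-1))).erase u) ∧
    (u ∈ cofaceDirections Z D (Function.update y u 1) ↔
      u ∈ cofaceDirections Z D (Function.update y u (-1))) := by
  have hz : ∀ a : SignType, a ≠ 0 → zeros (Function.update y u a) = zeros y := by
    intro a ha
    rw [zeros_update_of_ne_zero _ _ ha, Finset.erase_eq_of_notMem (by simpa using hyu)]
  have hp := hz 1 (by decide)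
  have hm := hz (-1) (by decide)
  refine ⟨?_, ?_, ?_⟩
  · ext j
    simp only [Finset.mem_union, Finset.mem_erase, mem_cofaceDirections, hp, hm]
    constructor
    · rintro ⟨hj, hj0, c, hc, hzc, h⟩
      rw [Finset.mem_insert, not_or] at hj
      have hcu : c u ≠ 0 := by
        intro h0
        have : u ∈ insert j (zeros y) := hzc ▸ mem_zeros.2 h0
        simp [Ne.symm hj.1, hyu] at this
      rcases sign_ne_zero_iff.1 hcu with hcu | hcu
      · refine Or.inl ⟨hj.1, hj.2, by simpa [hj.1] using hj0, c, hc, hzc, fun i hi hi' => ?_⟩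
        by_cases hiu : i = u
        · subst hiu; simpa using hcu
        · rw [Function.update_of_ne hiu]; exact h i (by simp [hi, hiu]) hi'
      · refine Or.inr ⟨hj.1, hj.2, by simpa [hj.1] using hj0, c, hc, hzc, fun i hi hi' => ?_⟩
        by_cases hiu : i = u
        · subst hiu; simpa using hcu
        · rw [Function.update_of_ne hiu]; exact h i (by simp [hi, hiu]) hi'
    · rintro (⟨hju, hj, hj0, c, hc, hzc, h⟩ | ⟨hju, hj, hj0, c, hc, hzc, h⟩) <;>
      · refine ⟨by simp [hju, hj], by simpa [hju] using hj0, c, hc, hzc, fun i hi hi' => ?_⟩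
        rw [Finset.mem_insert, not_or] at hi
        simpa [hi.1] using h i hi.2 hi'
  · rw [Finset.disjoint_left]
    intro j hj hj'
    simp only [Finset.mem_erase, mem_cofaceDirections, hp, hm] at hj hj'
    obtain ⟨hju, -, hj0, a, ha, hza, h⟩ := hj
    obtain ⟨-, -, -, b, hb, hzb, h'⟩ := hj'
    rw [Function.update_of_ne hju] at hj0
    have huj : u ∉ insert j (zeros y) := by simp [hyu, Ne.symm hju]
    -- The bound on `D` leaves a position `i` outside all these sets. There the two parallel cubes
    -- have the same nonzero sign, while at `u` their signs differ: they are neither equal nor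
    -- antipodal.
    have hcard : (insert u D ∪ insert j (zeros y)).card < (Finset.univ : Finset (Fin n)).card := by
      have h1 := Finset.card_union_le (insert u D) (insert j (zeros y))
      have h2 := Finset.card_insert_le u D
      have h3 := Finset.card_insert_le j (zeros y)
      rw [Finset.card_univ, Fintype.card_fin]
      omega
    obtain ⟨i, -, hi⟩ := Finset.exists_mem_notMem_of_card_lt_card hcard
    simp only [Finset.mem_union, not_or] at hi
    obtain ⟨hi1, hi2⟩ := hi
    rw [Finset.mem_insert, not_or] at hi1
    have e1 := h i hi1.2 hi2
    have e2 := h' i hi1.2 hi2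
    rw [Function.update_of_ne hi1.1] at e1 e2
    have hai : a i ≠ 0 := fun h0 => hi2 (hza ▸ mem_zeros.2 h0)
    have f1 := h u huD huj
    have f2 := h' u huD huj
    rw [Function.update_self] at f1 f2
    rcases (hZ a ha).2 b hb (hza.trans hzb.symm) with rfl | hab
    · rw [f1] at f2; exact absurd f2 (by decide)
    · have := congrFun hab i
      rw [Pi.neg_apply, e2, ← e1] at this
      exact sign_ne_neg_self hai this
  · simp only [mem_cofaceDirections, hp, hm, Function.update_self]
    refine and_congr_right fun _ => and_congr (by decide) (exists_congr fun c => ?_)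
    refine and_congr_right fun _ => and_congr_right fun _ => forall_congr' fun i => ?_
    refine forall_congr' fun _ => forall_congr' fun hi => ?_
    have hiu : i ≠ u := fun h => hi (by simp [h])
    rw [Function.update_of_ne hiu, Function.update_of_ne hiu]

/-- In a cycle that is an antipodal section, the deletion of positions gives cycles. -/
lemma even_card_cofaceDirections {k : ℕ} {Z : Finset (Cube n)} (hZ : IsAntipodalSection k Z)
    (hcyc : ∀ y, Even (Z.filter fun x => IsFacet y x).card) (D : Finset (Fin n))
    (hD : D.card + k < n) (y : Cube n) (hy : (zeros y).card + 1 = k) (hyD : ∀ i ∈ D, y i ≠ 0) :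
    Even (cofaceDirections Z D y).card := by
  induction D using Finset.induction_on generalizing y with
  | empty => rw [card_cofaceDirections_empty]; exact hcyc y
  | insert u D hu ih =>
    rw [Finset.card_insert_of_notMem hu] at hD
    have hyu := hyD u (by simp)
    have key : ∀ a : SignType, a ≠ 0 → Even (cofaceDirections Z D (Function.update y u a)).card := by
      intro a ha
      refine ih (by omega) _ ?_ fun i hi => ?_
      · rw [zeros_update_of_ne_zero _ _ ha, Finset.erase_eq_of_notMem (by simpa using hyu), hy]
      · rw [Function.update_of_ne (by rintro rfl; exact hu hi)]
        exact hyD i (by simp [hi])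
    obtain ⟨h1, h2, h3⟩ := cofaceDirections_insert hZ hu hD hy hyu
    have kp := key 1 (by decide)
    have km := key (-1) (by decide)
    rw [h1, Finset.card_union_of_disjoint h2]
    -- The direction `u` is erased from both sets or from neither, so the parity of the total is
    -- unaffected.
    by_cases hmem : u ∈ cofaceDirections Z D (Function.update y u 1)
    · have a1 := Finset.card_erase_add_one hmem
      have a2 := Finset.card_erase_add_one (h3.1 hmem)
      rw [← a1] at kp
      rw [← a2] at km
      rw [Nat.even_iff] at *
      omega
    · rw [Finset.erase_eq_of_notMem hmem, Finset.erase_eq_of_notMem (h3.not.1 hmem)]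
      exact kp.add km

/-- The cubes obtained from `z` by giving to one of its symbols `0` the sign prescribed by
`w`: the star of a vertex in the boundary of `z`. -/
def vertexStar (z w : Cube n) : Finset (Cube n) :=
  (zeros z).image fun t => Function.update z t (w t)

lemma mem_vertexStar {z w x : Cube n} :
    x ∈ vertexStar z w ↔ ∃ t, z t = 0 ∧ Function.update z t (w t) = x := by
  simp [vertexStar]

/-- If the star of a vertex in the boundary of the cube `z` belongs to a cycle that is an antipodal
section, then no cube of the cycle with another direction than those of `z` projects, in the
directions of `z`, to a cube having this vertex. -/
theorem not_le_vertex_of_vertexStar_subset {k : ℕ} {Z : Finset (Cube n)}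
    (hZ : IsAntipodalSection k Z) (hcyc : ∀ y, Even (Z.filter fun x => IsFacet y x).card)
    {z w : Cube n} (hz : dim z = k + 1) (hw : ∀ t, z t = 0 → w t ≠ 0)
    (hstar : vertexStar z w ⊆ Z) {c : Cube n} (hc : c ∈ Z) {s : Fin n} (hcs : c s = 0)
    (hzs : z s ≠ 0) : ¬ ∀ t, z t = 0 → c t = 0 ∨ c t = w t := by
  intro hct
  have hsz : s ∉ zeros z := by simpa using hzs
  have hTc : (insert s (zeros z)).card = k + 2 := by
    rw [Finset.card_insert_of_notMem hsz]; unfold dim at hz; omega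
  have hle : k + 2 ≤ n := by
    rw [← hTc]; simpa using Finset.card_le_univ (insert s (zeros z))
  have hDc : ∀ D, Disjoint D (insert s (zeros z)) → D.card + k < n := by
    intro D hD
    have := Finset.card_le_univ (D ∪ insert s (zeros z))
    rw [Finset.card_union_of_disjoint hD, hTc, Fintype.card_fin] at this
    omega
  -- The symbols `0` of `c` outside `z` and `s` are removed one at a time: by parity, the facet
  -- obtained by giving a sign to the position `u` has a second coface after deletion of `D`.
  have step : ∀ D : Finset (Fin n), Disjoint D (insert s (zeros z)) →
      ∃ c ∈ Z, c s = 0 ∧ (∀ i ∈ D, c i ≠ 0) ∧ ∀ t, z t = 0 → c t = 0 ∨ c t = w t := by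
    intro D
    induction D using Finset.induction_on with
    | empty => exact fun _ => ⟨c, hc, hcs, by simp, hct⟩
    | insert u D hu ih =>
      intro hdis
      rw [Finset.disjoint_insert_left] at hdis
      obtain ⟨hus, hD⟩ := hdis
      rw [Finset.mem_insert, not_or, mem_zeros] at hus
      obtain ⟨c, hc, hcs, hcD, hct⟩ := ih hD
      by_cases hcu : c u = 0
      · have hzy : zeros (Function.update c u 1) = (zeros c).erase u :=
          zeros_update_of_ne_zero _ _ (by decide)
        have hins : insert u ((zeros c).erase u) = zeros c :=
          Finset.insert_erase (by simpa using hcu)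
        have hcc : (zeros c).card = k := (hZ c hc).1
        have hpos : 0 < (zeros c).card := Finset.card_pos.2 ⟨u, by simpa using hcu⟩
        have hev := even_card_cofaceDirections hZ hcyc D (hDc D hD) (Function.update c u 1)
          (by rw [hzy, Finset.card_erase_of_mem (by simpa using hcu)]; omega)
          (fun i hi => by
            rw [Function.update_of_ne (by rintro rfl; exact hu hi)]; exact hcD i hi)
        have hmem : u ∈ cofaceDirections Z D (Function.update c u 1) := by
          rw [mem_cofaceDirections]
          refine ⟨hu, by simp, c, hc, by rw [hzy, hins], fun i _ hi => ?_⟩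
          rw [Function.update_of_ne (by rintro rfl; simp at hi)]
        have hone : 1 < (cofaceDirections Z D (Function.update c u 1)).card := by
          have := Finset.card_pos.2 ⟨u, hmem⟩
          rw [Nat.even_iff] at hev
          omega
        -- The second coface trades the `0` at `u` for a `0` at some `j ∉ D`. Signs may change only
        -- inside `D`, which avoids `s` and the directions of `z`.
        obtain ⟨j, hj, hju⟩ := Finset.exists_mem_ne hone u
        obtain ⟨hjD, hj0, c', hc', hzc', h'⟩ := mem_cofaceDirections.1 hj
        rw [hzy] at hzc' h'
        have hz0 : ∀ i, c' i = 0 ↔ i = j ∨ (i ≠ u ∧ c i = 0) := by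
          intro i
          rw [← mem_zeros, hzc']; simp
        refine ⟨c', hc', (hz0 s).2 (Or.inr ⟨Ne.symm hus.1, hcs⟩), ?_, ?_⟩
        · intro i hi
          rw [Ne, hz0, not_or]
          rcases Finset.mem_insert.1 hi with rfl | hi
          · exact ⟨Ne.symm hju, by simp⟩
          · exact ⟨by rintro rfl; exact hjD hi, fun h => hcD i hi h.2⟩
        · intro t ht
          by_cases h0 : c' t = 0
          · exact Or.inl h0
          have htu : t ≠ u := by rintro rfl; exact hus.2 ht
          have htD : t ∉ D := fun h => (Finset.disjoint_left.1 hD) h (by simp [ht])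
          have := h' t htD (by rw [← hzc']; simpa using h0)
          rw [Function.update_of_ne htu] at this
          rw [this]
          exact hct t ht
      · refine ⟨c, hc, hcs, ?_, hct⟩
        intro i hi
        rcases Finset.mem_insert.1 hi with rfl | hi
        · exact hcu
        · exact hcD i hi
  have hdis : Disjoint (insert s (zeros z))ᶜ (insert s (zeros z)) := disjoint_compl_left
  obtain ⟨c, hc, hcs, hcD, hct⟩ := step _ hdis
  have hcsub : zeros c ⊆ insert s (zeros z) := by
    intro i hi
    by_contra h
    exact hcD i (by simpa using h) (by simpa using hi)
  have hcc : (zeros c).card = k := (hZ c hc).1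
  have hsc : s ∈ zeros c := by simpa using hcs
  have hRsub : (zeros c).erase s ⊆ zeros z := by
    intro i hi
    rw [Finset.mem_erase] at hi
    exact Finset.mem_of_mem_insert_of_ne (hcsub hi.2) hi.1
  have hRc : ((zeros c).erase s).card + 1 = k := by
    rw [Finset.card_erase_add_one hsc, hcc]
  have htwo : (zeros z \ (zeros c).erase s).card = 2 := by
    rw [Finset.card_sdiff_of_subset hRsub]; unfold dim at hz; omega
  obtain ⟨t, t', htt, hpair⟩ := Finset.card_eq_two.1 htwo
  have hpair' : ∀ i, (z i = 0 ∧ ¬ (i ≠ s ∧ c i = 0)) ↔ i = t ∨ i = t' := by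
    intro i
    have := congrArg (i ∈ ·) hpair
    simpa using this
  -- The offending face: the directions of `c` other than `s`, the signs of the vertex `w` in the
  -- two remaining directions `t`, `t'` of `z`, and the sign of `z` at `s`.
  set y : Cube n := fun i => if i ∈ (zeros c).erase s then 0 else if z i = 0 then w i else z i
    with hydef
  have hy0 : ∀ i, y i = 0 ↔ i ∈ (zeros c).erase s := by
    intro i
    simp only [hydef]
    split_ifs with h1 h2
    · simp [h1]
    · simp [h1, hw i h2]
    · simp [h1, h2]
  have hzy : zeros y = (zeros c).erase s := by
    ext i; rw [mem_zeros, hy0]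
  have hev := even_card_cofaceDirections hZ hcyc _ (hDc _ hdis) y (by rw [hzy, hRc]) (by
    intro i hi h0
    rw [hy0] at h0
    exact (Finset.mem_compl.1 hi) (Finset.mem_insert_of_mem (hRsub h0)))
  have hstarcoface : ∀ a b, a ≠ b → (∀ i, (z i = 0 ∧ ¬ (i ≠ s ∧ c i = 0)) ↔ i = a ∨ i = b) →
      a ∈ cofaceDirections Z (insert s (zeros z))ᶜ y := by
    intro a b hab hp
    have ha := (hp a).2 (Or.inl rfl)
    have hb := (hp b).2 (Or.inr rfl)
    refine mem_cofaceDirections.2 ⟨by simp [ha.1], ?_, Function.update z b (w b),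
      hstar (mem_vertexStar.2 ⟨b, hb.1, rfl⟩), ?_, ?_⟩
    · rw [Ne, hy0]; simpa using ha.2
    · rw [hzy, zeros_update_of_ne_zero _ _ (hw b hb.1)]
      ext i
      have := hp i
      have hR : i ∈ (zeros c).erase s → i ∈ zeros z := fun h => hRsub h
      simp only [Finset.mem_erase, Finset.mem_insert, mem_zeros] at hR ⊢
      constructor
      · rintro ⟨hib, hi⟩
        by_contra hcon
        rw [not_or] at hcon
        exact (this.1 ⟨hi, hcon.2⟩).elim hcon.1 hib
      · rintro (rfl | hi)
        · exact ⟨hab, ha.1⟩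
        · refine ⟨?_, hR hi⟩
          rintro rfl
          exact hb.2 hi
    · intro i _ hi
      rw [hzy, Finset.mem_insert, not_or] at hi
      simp only [hydef, if_neg hi.2]
      by_cases hib : i = b
      · subst hib; simp [hb.1]
      · rw [Function.update_of_ne hib, if_neg]
        intro hzi
        have h2 := hi.2
        rw [Finset.mem_erase, mem_zeros] at h2
        exact ((hp i).1 ⟨hzi, h2⟩).elim hi.1 hib
  -- Only `t`, `t'` and `s` are left as possible directions. The first two are realized by the cubes
  -- of the star, the third by `c`.
  have hthree : cofaceDirections Z (insert s (zeros z))ᶜ y = {t, t', s} := by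
    ext j
    simp only [Finset.mem_insert, Finset.mem_singleton]
    constructor
    · intro hj
      obtain ⟨hj1, hj2, -⟩ := mem_cofaceDirections.1 hj
      rw [Ne, hy0, Finset.mem_erase, mem_zeros] at hj2
      simp only [Finset.mem_compl, not_not, Finset.mem_insert, mem_zeros] at hj1
      rcases hj1 with rfl | hj1
      · simp
      · rcases (hpair' j).1 ⟨hj1, hj2⟩ with rfl | rfl <;> simp
    · rintro (rfl | rfl | rfl)
      · exact hstarcoface _ _ htt hpair'
      · exact hstarcoface _ _ htt.symm fun i => (hpair' i).trans or_comm
      · refine mem_cofaceDirections.2 ⟨by simp, by simp [hy0], c, hc, ?_, ?_⟩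
        · rw [hzy, Finset.insert_erase hsc]
        · intro i hi hi'
          rw [hzy, Finset.insert_erase hsc] at hi'
          simp only [Finset.mem_compl, not_not, Finset.mem_insert] at hi
          have his : i ≠ j := by rintro rfl; exact hi' hsc
          have hzi : z i = 0 := by simpa [his] using hi
          have hci : c i ≠ 0 := by simpa using hi'
          simp only [hydef, Finset.mem_erase, mem_zeros, hci, and_false, if_false, hzi, if_true]
          exact (hct i hzi).resolve_left hci
  have hst : s ≠ t := by rintro rfl; exact hzs ((hpair' s).2 (Or.inl rfl)).1
  have hst' : s ≠ t' := by rintro rfl; exact hzs ((hpair' s).2 (Or.inr rfl)).1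
  have h3 : ({t, t', s} : Finset (Fin n)).card = 3 :=
    Finset.card_eq_three.2 ⟨t, t', s, htt, hst.symm, hst'.symm, rfl⟩
  rw [hthree, h3] at hev
  exact absurd hev (by decide)

/-! ### Sections and flips -/

lemma IsSection.eq_of_zeros_eq {k : ℕ} {v : Finset (Cube n)} (hv : IsSection k v) {a b : Cube n}
    (ha : a ∈ v) (hb : b ∈ v) (h : zeros a = zeros b) : a = b :=
  (hv.2 (zeros b) (hv.1 b hb)).unique ⟨ha, h⟩ ⟨hb, rfl⟩

lemma IsSection.card_eq {k : ℕ} {v : Finset (Cube n)} (hv : IsSection k v) :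
    v.card = n.choose k := by
  have : v.card = (Finset.powersetCard k (Finset.univ : Finset (Fin n))).card := by
    refine Finset.card_bij (fun x _ => zeros x) ?_ ?_ ?_
    · intro x hx
      rw [Finset.mem_powersetCard]
      exact ⟨Finset.subset_univ _, hv.1 x hx⟩
    · exact fun a ha b hb h => hv.eq_of_zeros_eq ha hb h
    · intro S hS
      obtain ⟨x, ⟨hx, hxS⟩, -⟩ := hv.2 S (Finset.mem_powersetCard.1 hS).2
      exact ⟨x, hx, hxS⟩
  rw [this, Finset.card_powersetCard, Finset.card_univ, Fintype.card_fin]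

lemma zeros_vertexStar {z w : Cube n} (hw : ∀ t, z t = 0 → w t ≠ 0) {t : Fin n} (ht : z t = 0) :
    zeros (Function.update z t (w t)) = (zeros z).erase t :=
  zeros_update_of_ne_zero _ _ (hw t ht)

lemma vertexStar_neg_ne_zero {z w : Cube n} (hw : ∀ t, z t = 0 → w t ≠ 0) :
    ∀ t, z t = 0 → (-w) t ≠ 0 := fun t ht => sign_neg_ne_zero (hw t ht)

lemma image_zeros_vertexStar {z w : Cube n} (hw : ∀ t, z t = 0 → w t ≠ 0) :
    (vertexStar z w).image zeros = (zeros z).image (zeros z).erase := by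
  rw [vertexStar, Finset.image_image]
  refine Finset.image_congr fun t ht => ?_
  exact zeros_vertexStar hw (by simpa using ht)

lemma erase_zeros_injOn {z : Cube n} {t t' : Fin n} (ht : z t = 0)
    (h : (zeros z).erase t = (zeros z).erase t') : t = t' := by
  by_contra hne
  have : t ∈ (zeros z).erase t := by rw [h]; simp [hne, ht]
  simp at this

/-- Replace the star of the vertex `w` in the boundary of `z` by that of the opposite vertex. -/
def flip (v : Finset (Cube n)) (z w : Cube n) : Finset (Cube n) :=
  (v \ vertexStar z w) ∪ vertexStar z (-w)

lemma IsSection.disjoint_vertexStar_neg {k : ℕ} {v : Finset (Cube n)} (hv : IsSection k v)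
    {z w : Cube n} (hw : ∀ t, z t = 0 → w t ≠ 0) (hA : vertexStar z w ⊆ v) :
    Disjoint (v \ vertexStar z w) (vertexStar z (-w)) := by
  rw [Finset.disjoint_left]
  intro b hb hb'
  rw [Finset.mem_sdiff] at hb
  obtain ⟨t, ht, rfl⟩ := mem_vertexStar.1 hb'
  have ha : Function.update z t (w t) ∈ vertexStar z w := mem_vertexStar.2 ⟨t, ht, rfl⟩
  refine hb.2 ?_
  rw [hv.eq_of_zeros_eq hb.1 (hA ha)]
  · exact ha
  · rw [zeros_vertexStar hw ht, zeros_vertexStar (vertexStar_neg_ne_zero hw) ht]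

/-- Opposite facets of `z` are parallel, so each parallel class loses and regains one
representative. -/
lemma IsSection.flip {k : ℕ} {v : Finset (Cube n)} (hv : IsSection k v)
    {z w : Cube n} (hw : ∀ t, z t = 0 → w t ≠ 0) (hA : vertexStar z w ⊆ v) :
    IsSection k (flip v z w) := by
  have hw' := vertexStar_neg_ne_zero hw
  constructor
  · intro x hx
    rcases Finset.mem_union.1 hx with hx | hx
    · exact hv.1 x (Finset.mem_sdiff.1 hx).1
    · obtain ⟨t, ht, rfl⟩ := mem_vertexStar.1 hx
      rw [← hv.1 _ (hA (mem_vertexStar.2 ⟨t, ht, rfl⟩)), dim, dim, zeros_vertexStar hw ht,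
        zeros_vertexStar hw' ht]
  · intro S hS
    obtain ⟨x, ⟨hx, hxS⟩, huniq⟩ := hv.2 S hS
    by_cases hxA : x ∈ vertexStar z w
    · obtain ⟨t, ht, rfl⟩ := mem_vertexStar.1 hxA
      refine ⟨Function.update z t ((-w) t), ⟨Finset.mem_union_right _
        (mem_vertexStar.2 ⟨t, ht, rfl⟩), ?_⟩, ?_⟩
      · rw [← hxS, zeros_vertexStar hw ht, zeros_vertexStar hw' ht]
      · rintro b ⟨hb, hbS⟩
        rcases Finset.mem_union.1 hb with hb | hb
        · rw [Finset.mem_sdiff] at hb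
          exact absurd (huniq b ⟨hb.1, hbS⟩ ▸ hxA) hb.2
        · obtain ⟨t', ht', rfl⟩ := mem_vertexStar.1 hb
          rw [← hxS, zeros_vertexStar hw' ht', zeros_vertexStar hw ht] at hbS
          rw [erase_zeros_injOn ht' hbS]
    · refine ⟨x, ⟨Finset.mem_union_left _ (Finset.mem_sdiff.2 ⟨hx, hxA⟩), hxS⟩, ?_⟩
      rintro b ⟨hb, hbS⟩
      rcases Finset.mem_union.1 hb with hb | hb
      · exact huniq b ⟨(Finset.mem_sdiff.1 hb).1, hbS⟩
      · obtain ⟨t, ht, rfl⟩ := mem_vertexStar.1 hb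
        have ha : Function.update z t (w t) ∈ vertexStar z w := mem_vertexStar.2 ⟨t, ht, rfl⟩
        refine absurd ?_ hxA
        rw [← huniq _ ⟨hA ha, ?_⟩]
        · exact ha
        · rw [← hbS, zeros_vertexStar hw ht, zeros_vertexStar hw' ht]

/-- A face of codimension two of a cube belongs to exactly two of its facets. -/
lemma isFacet_update_pair {z y : Cube n} {t : Fin n} {a : SignType} (ht : z t = 0) (ha : a ≠ 0)
    (h : IsFacet y (Function.update z t a)) :
    ∃ j, j ≠ t ∧ z j = 0 ∧ y j ≠ 0 ∧ y t = a ∧ ∀ t' a', z t' = 0 → a' ≠ 0 →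
      (IsFacet y (Function.update z t' a') ↔ (t' = t ∧ a' = a) ∨ (t' = j ∧ a' = y j)) := by
  obtain ⟨j, hj, e⟩ := isFacet_iff.1 h
  have hjt : j ≠ t := by
    rintro rfl
    have := congrFun e j
    simp at this
    exact ha this
  have hyt : y t = a := by
    have := congrFun e t
    rw [Function.update_self, Function.update_of_ne hjt.symm] at this
    exact this.symm
  have hzj : z j = 0 := by
    have := congrFun e j
    rwa [Function.update_self, Function.update_of_ne hjt] at this
  refine ⟨j, hjt, hzj, hj, hyt, fun t' a' ht' ha' => ⟨fun h' => ?_, ?_⟩⟩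
  · obtain ⟨j', hj', e'⟩ := isFacet_iff.1 h'
    have hyt' : y t' = a' := by
      have := congrFun e' t'
      rw [Function.update_self] at this
      by_cases hc : t' = j'
      · subst hc; simp at this; exact absurd this ha'
      · rw [Function.update_of_ne hc] at this; exact this.symm
    by_cases h1 : t' = t
    · subst h1; exact Or.inl ⟨rfl, hyt'.symm.trans hyt⟩
    by_cases h2 : t' = j
    · subst h2; exact Or.inr ⟨rfl, hyt'.symm⟩
    exfalso
    have f1 := congrFun e' t
    have f2 := congrFun e' j
    rw [Function.update_of_ne (Ne.symm h1), ht] at f1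
    rw [Function.update_of_ne (Ne.symm h2), hzj] at f2
    have g1 : t = j' := by
      by_contra hc
      rw [Function.update_of_ne hc, hyt] at f1
      exact ha f1.symm
    have g2 : j = j' := by
      by_contra hc
      rw [Function.update_of_ne hc] at f2
      exact hj f2.symm
    exact hjt (g2.trans g1.symm)
  · rintro (⟨rfl, rfl⟩ | ⟨rfl, rfl⟩)
    · exact h
    · rw [isFacet_iff]
      refine ⟨t, by rwa [hyt], ?_⟩
      ext i : 1
      by_cases h1 : i = t
      · subst h1; simp [Function.update_of_ne hjt.symm, ht]
      rw [Function.update_of_ne h1]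
      by_cases h2 : i = t'
      · subst h2; simp
      rw [Function.update_of_ne h2]
      have := congrFun e i
      rwa [Function.update_of_ne h1, Function.update_of_ne h2] at this

lemma disjoint_vertexStar {z w : Cube n} (hw : ∀ t, z t = 0 → w t ≠ 0) :
    Disjoint (vertexStar z w) (vertexStar z (-w)) := by
  rw [Finset.disjoint_left]
  intro b hb hb'
  obtain ⟨t, ht, rfl⟩ := mem_vertexStar.1 hb
  obtain ⟨t', ht', e⟩ := mem_vertexStar.1 hb'
  have : t' = t := by
    refine erase_zeros_injOn ht' ?_
    rw [← zeros_vertexStar hw ht, ← zeros_vertexStar (vertexStar_neg_ne_zero hw) ht', e]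
  subst this
  have := congrFun e t'
  simp at this
  exact hw _ ht this

lemma mem_vertexStar_union {z w x : Cube n} (hw : ∀ t, z t = 0 → w t ≠ 0) :
    x ∈ vertexStar z w ∪ vertexStar z (-w) ↔
      ∃ t a, z t = 0 ∧ a ≠ 0 ∧ x = Function.update z t a := by
  rw [Finset.mem_union, mem_vertexStar, mem_vertexStar]
  constructor
  · rintro (⟨t, ht, rfl⟩ | ⟨t, ht, rfl⟩)
    · exact ⟨t, _, ht, hw t ht, rfl⟩
    · exact ⟨t, _, ht, vertexStar_neg_ne_zero hw t ht, rfl⟩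
  · rintro ⟨t, a, ht, ha, rfl⟩
    rcases sign_eq_or_eq_neg ha (hw t ht) with rfl | rfl
    · exact Or.inl ⟨t, ht, rfl⟩
    · exact Or.inr ⟨t, ht, rfl⟩

/-- The two stars together consist of all facets of `z`, and these form a cycle: a face of
codimension two lies in exactly two of them. -/
lemma even_card_facets {z w : Cube n} (hw : ∀ t, z t = 0 → w t ≠ 0) (y : Cube n) :
    Even ((vertexStar z w ∪ vertexStar z (-w)).filter fun x => IsFacet y x).card := by
  rcases Finset.eq_empty_or_nonempty
    ((vertexStar z w ∪ vertexStar z (-w)).filter fun x => IsFacet y x) with h | ⟨x, hx⟩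
  · simp [h]
  · rw [Finset.mem_filter, mem_vertexStar_union hw] at hx
    obtain ⟨⟨t, a, ht, ha, rfl⟩, hx⟩ := hx
    obtain ⟨j, hjt, hzj, hyj, hyt, hpair⟩ := isFacet_update_pair ht ha hx
    have : ((vertexStar z w ∪ vertexStar z (-w)).filter fun x => IsFacet y x)
        = {Function.update z t a, Function.update z j (y j)} := by
      ext x
      rw [Finset.mem_filter, mem_vertexStar_union hw, Finset.mem_insert, Finset.mem_singleton]
      constructor
      · rintro ⟨⟨t', a', ht', ha', rfl⟩, hx'⟩
        rcases (hpair t' a' ht' ha').1 hx' with ⟨rfl, rfl⟩ | ⟨rfl, rfl⟩ <;> simp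
      · rintro (rfl | rfl)
        · exact ⟨⟨t, a, ht, ha, rfl⟩, hx⟩
        · exact ⟨⟨j, _, hzj, hyj, rfl⟩, (hpair j _ hzj hyj).2 (Or.inr ⟨rfl, rfl⟩)⟩
    rw [this, Finset.card_pair]
    · decide
    · intro h
      have := congrFun h j
      rw [Function.update_self, Function.update_of_ne hjt, hzj] at this
      exact hyj this.symm

lemma cellBoundary_flip {k : ℕ} {v : Finset (Cube n)} (hv : IsSection k v)
    {z w : Cube n} (hw : ∀ t, z t = 0 → w t ≠ 0) (hA : vertexStar z w ⊆ v) :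
    cellBoundary (flip v z w) = cellBoundary v := by
  ext y
  rw [mem_cellBoundary, mem_cellBoundary]
  have hev := even_card_facets hw y
  rw [Finset.filter_union, Finset.card_union_of_disjoint
    (Finset.disjoint_filter_filter (disjoint_vertexStar hw))] at hev
  have h1 : (v.filter fun x => IsFacet y x).card
      = ((v \ vertexStar z w).filter fun x => IsFacet y x).card
        + ((vertexStar z w).filter fun x => IsFacet y x).card := by
    rw [← Finset.card_union_of_disjoint (Finset.disjoint_filter_filter Finset.sdiff_disjoint),
      ← Finset.filter_union, Finset.sdiff_union_of_subset hA]
  have h2 : ((flip v z w).filter fun x => IsFacet y x).card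
      = ((v \ vertexStar z w).filter fun x => IsFacet y x).card
        + ((vertexStar z (-w)).filter fun x => IsFacet y x).card := by
    rw [← Finset.card_union_of_disjoint
      (Finset.disjoint_filter_filter (hv.disjoint_vertexStar_neg hw hA)),
      ← Finset.filter_union, flip]
  rw [h1, h2, Nat.odd_iff, Nat.odd_iff]
  rw [Nat.even_iff] at hev
  omega

/-- A cell of the boundary is either a face of a cell outside the star, or contained in
the boundary of the star. -/
lemma mem_cellBoundary_cases {v : Finset (Cube n)} {z w : Cube n}
    (hw : ∀ t, z t = 0 → w t ≠ 0) (hA : vertexStar z w ⊆ v) {y : Cube n}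
    (hy : y ∈ cellBoundary v) :
    (∃ c ∈ v \ vertexStar z w, IsFacet y c) ∨
      ∃ x ∈ vertexStar z w, IsFacet y x ∧ ∃ j, z j = 0 ∧ y j = -w j := by
  by_contra hcon
  rw [not_or] at hcon
  obtain ⟨h1, h2⟩ := hcon
  have hfil : (v.filter fun x => IsFacet y x) = (vertexStar z w).filter fun x => IsFacet y x := by
    ext x
    rw [Finset.mem_filter, Finset.mem_filter]
    refine and_congr_left fun hx => ⟨fun hxv => ?_, fun h => hA h⟩
    by_contra hxA
    exact h1 ⟨x, Finset.mem_sdiff.2 ⟨hxv, hxA⟩, hx⟩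
  rw [mem_cellBoundary, hfil] at hy
  obtain ⟨x, hx⟩ := Finset.card_pos.1 hy.pos
  rw [Finset.mem_filter] at hx
  obtain ⟨t, ht, rfl⟩ := mem_vertexStar.1 hx.1
  obtain ⟨j, hjt, hzj, hyj, hyt, hpair⟩ := isFacet_update_pair ht (hw t ht) hx.2
  have hyw : y j = w j := by
    refine (sign_eq_or_eq_neg hyj (hw j hzj)).resolve_right fun h => ?_
    exact h2 ⟨_, hx.1, hx.2, j, hzj, h⟩
  -- A face whose signs in the directions of `z` all agree with `w` is interior to the star: both
  -- facets of `z` containing it belong to the star, so it is counted twice.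
  have : (vertexStar z w).filter (fun x => IsFacet y x)
      = {Function.update z t (w t), Function.update z j (w j)} := by
    ext x
    rw [Finset.mem_filter, mem_vertexStar, Finset.mem_insert, Finset.mem_singleton]
    constructor
    · rintro ⟨⟨t', ht', rfl⟩, hx'⟩
      rcases (hpair t' _ ht' (hw t' ht')).1 hx' with ⟨rfl, -⟩ | ⟨rfl, -⟩ <;> simp
    · rintro (rfl | rfl)
      · exact ⟨⟨t, ht, rfl⟩, hx.2⟩
      · exact ⟨⟨j, hzj, rfl⟩, (hpair j _ hzj (hw j hzj)).2 (Or.inr ⟨rfl, hyw.symm⟩)⟩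
  rw [this, Finset.card_pair] at hy
  · exact absurd hy (by decide)
  · intro h
    have := congrFun h j
    rw [Function.update_self, Function.update_of_ne hjt, hzj] at this
    exact hw j hzj this.symm

/-! ### The antipodal double of a section -/

/-- The double of a section along an antipodally invariant boundary is a cycle. -/
lemma IsSection.double {k : ℕ} {v : Finset (Cube n)} (hv : IsSection k v) (hk : k < n)
    (hneg : ∀ y ∈ cellBoundary v, -y ∈ cellBoundary v) :
    IsAntipodalSection k (v ∪ v.image fun x => -x) ∧
      ∀ y, Even ((v ∪ v.image fun x => -x).filter fun x => IsFacet y x).card := by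
  constructor
  · intro a ha
    rw [Finset.mem_union, mem_image_neg] at ha
    constructor
    · rcases ha with ha | ha
      · exact hv.1 a ha
      · rw [← dim_neg]; exact hv.1 _ ha
    · intro b hb h
      rw [Finset.mem_union, mem_image_neg] at hb
      rcases ha with ha | ha <;> rcases hb with hb | hb
      · exact Or.inl (hv.eq_of_zeros_eq ha hb h)
      · exact Or.inr (hv.eq_of_zeros_eq ha hb (by rw [h, zeros_neg]))
      · exact Or.inr (neg_eq_iff_eq_neg.1 (hv.eq_of_zeros_eq ha hb (by rw [← h, zeros_neg])))
      · exact Or.inl (neg_inj.1 (hv.eq_of_zeros_eq ha hb (by rw [zeros_neg, zeros_neg, h])))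
  · intro y
    -- A cube parallel to its antipode inside a section equals it, so all its symbols are `0`; this
    -- is excluded by `k < n`.
    have hdis : Disjoint v (v.image fun x => -x) := by
      rw [Finset.disjoint_left]
      intro x hx hx'
      rw [mem_image_neg] at hx'
      have h := hv.eq_of_zeros_eq hx hx' (zeros_neg x).symm
      have huniv : zeros x = Finset.univ := by
        ext i
        simp only [mem_zeros, Finset.mem_univ, iff_true]
        by_contra h0
        exact sign_ne_neg_self h0 (congrFun h i)
      have := hv.1 x hx
      rw [dim, huniv, Finset.card_univ, Fintype.card_fin] at this
      omega
    rw [Finset.filter_union, Finset.card_union_of_disjoint (Finset.disjoint_filter_filter hdis),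
      Nat.even_add', ← mem_cellBoundary, ← mem_cellBoundary, mem_cellBoundary_image_neg]
    exact ⟨hneg y, fun h => by simpa using hneg _ h⟩

/-- A cell of the section outside the star contains neither the vertex of the star nor, in the
directions of `z`, the opposite one. -/
lemma IsSection.exists_sign_of_notMem_vertexStar {k : ℕ} {v : Finset (Cube n)}
    (hv : IsSection k v) (hneg : ∀ y ∈ cellBoundary v, -y ∈ cellBoundary v)
    {z w : Cube n} (hz : dim z = k + 1) (hw : ∀ t, z t = 0 → w t ≠ 0)
    (hA : vertexStar z w ⊆ v) {c : Cube n} (hc : c ∈ v) (hcA : c ∉ vertexStar z w) :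
    (∃ t, z t = 0 ∧ c t = -w t) ∧ ∃ t, z t = 0 ∧ c t = w t := by
  have hk : k < n := by
    have : dim z ≤ n := by simpa [dim] using Finset.card_le_univ (zeros z)
    omega
  obtain ⟨hZ, hcyc⟩ := hv.double hk hneg
  -- Otherwise the directions of `c` are those of `z` with one omitted. Then `c` is parallel to a
  -- cube of the star, hence equal to it.
  obtain ⟨s, hcs, hzs⟩ : ∃ s, c s = 0 ∧ z s ≠ 0 := by
    by_contra hcon
    push Not at hcon
    have hsub : zeros c ⊆ zeros z := fun i hi => by
      rw [mem_zeros] at hi ⊢; exact hcon i hi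
    have hone : (zeros z \ zeros c).card = 1 := by
      have h1 := hv.1 c hc
      rw [Finset.card_sdiff_of_subset hsub]; unfold dim at hz h1; omega
    obtain ⟨t, ht⟩ := Finset.card_eq_one.1 hone
    have ht' : t ∈ zeros z \ zeros c := by simp [ht]
    have htz : z t = 0 := by simpa using (Finset.mem_sdiff.1 ht').1
    have ha : Function.update z t (w t) ∈ vertexStar z w := mem_vertexStar.2 ⟨t, htz, rfl⟩
    have hzc : zeros c = (zeros z).erase t := by
      rw [Finset.erase_eq, ← ht, Finset.sdiff_sdiff_eq_self hsub]
    rw [hv.eq_of_zeros_eq hc (hA ha) (by rw [hzc, zeros_vertexStar hw htz])] at hcA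
    exact hcA ha
  have h1 := not_le_vertex_of_vertexStar_subset hZ hcyc hz hw
    (hA.trans Finset.subset_union_left) (Finset.mem_union_left _ hc) hcs hzs
  have h2 := not_le_vertex_of_vertexStar_subset hZ hcyc hz hw
    (hA.trans Finset.subset_union_left) (c := -c)
    (Finset.mem_union_right _ (mem_image_neg.2 (by simpa using hc)))
    (by simp [hcs]) hzs
  push Not at h1 h2
  obtain ⟨t, ht, h0, h1⟩ := h1
  obtain ⟨t', ht', h0', h2⟩ := h2
  refine ⟨⟨t, ht, (sign_eq_or_eq_neg h0 (hw t ht)).resolve_left h1⟩, t', ht', ?_⟩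
  have := (sign_eq_or_eq_neg h0' (hw t' ht')).resolve_left h2
  simpa using this

/-! ### Geometric realization -/

lemma sign_cast_injective : Function.Injective (fun a : SignType => (a : ℝ)) := by
  intro a b
  cases a <;> cases b <;> simp <;> norm_num

lemma mem_realize {x : Cube n} {p : Fin n → ℝ} :
    p ∈ realize x ↔ ∀ i, if x i = 0 then p i ∈ Set.Icc (-1 : ℝ) 1 else p i = (x i : ℝ) :=
  Iff.rfl

lemma mem_support {v : Finset (Cube n)} {p : Fin n → ℝ} :
    p ∈ support v ↔ ∃ x ∈ v, p ∈ realize x := by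
  simp [support]

lemma support_union (u v : Finset (Cube n)) : support (u ∪ v) = support u ∪ support v := by
  ext p
  simp only [Set.mem_union, mem_support, Finset.mem_union, or_and_right, exists_or]

lemma isClosed_realize (x : Cube n) : IsClosed (realize x) := by
  have : realize x = ⋂ i, {p | if x i = 0 then p i ∈ Set.Icc (-1 : ℝ) 1 else p i = (x i : ℝ)} := by
    ext p; simp [mem_realize]
  rw [this]
  refine isClosed_iInter fun i => ?_
  split_ifs
  · exact isClosed_Icc.preimage (continuous_apply i)
  · exact isClosed_eq (continuous_apply i) continuous_const

lemma isClosed_support (v : Finset (Cube n)) : IsClosed (support v) :=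
  v.finite_toSet.isClosed_biUnion fun x _ => isClosed_realize x

lemma realize_subset_of_isFacet {y x : Cube n} (h : IsFacet y x) : realize y ⊆ realize x := by
  intro p hp i
  have := hp i
  by_cases hx : x i = 0
  · rw [if_pos hx]
    split_ifs at this with hy
    · exact this
    · rw [this]; cases y i <;> simp
  · rw [if_neg hx]
    rwa [h.1 i hx, if_neg hx] at this

lemma neg_mem_realize {x : Cube n} {p : Fin n → ℝ} : -p ∈ realize (-x) ↔ p ∈ realize x := by
  refine forall_congr' fun i => ?_
  simp only [Pi.neg_apply]
  cases x i <;> simp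
  · constructor <;> rintro ⟨h1, h2⟩ <;> constructor <;> linarith
  · exact neg_eq_iff_eq_neg

lemma mem_support_image_neg {v : Finset (Cube n)} {p : Fin n → ℝ} :
    p ∈ support (v.image fun x => -x) ↔ -p ∈ support v := by
  simp only [mem_support, mem_image_neg]
  constructor
  · rintro ⟨x, hx, h⟩
    exact ⟨-x, hx, neg_mem_realize.2 h⟩
  · rintro ⟨x, hx, h⟩
    exact ⟨-x, by simpa using hx, by simpa using neg_mem_realize.2 h⟩

lemma cellBoundary_image_neg (v : Finset (Cube n)) :
    cellBoundary (v.image fun x => -x) = (cellBoundary v).image fun x => -x := by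
  ext y
  rw [mem_cellBoundary_image_neg, mem_image_neg]

lemma mem_boundary_image_neg {v : Finset (Cube n)} {p : Fin n → ℝ} :
    p ∈ boundary (v.image fun x => -x) ↔ -p ∈ boundary v := by
  rw [boundary, cellBoundary_image_neg, mem_support_image_neg, boundary]

/-- The centre of a cube lies in no other cube of the same dimension. -/
lemma eq_of_centre_mem_realize {y x : Cube n} (h : (fun i => (y i : ℝ)) ∈ realize x)
    (hd : dim x = dim y) : x = y := by
  have hxy : ∀ i, x i ≠ 0 → y i = x i := by
    intro i hx
    have := h i
    rw [if_neg hx] at this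
    exact sign_cast_injective this
  have hsub : zeros y ⊆ zeros x := by
    intro i hi
    rw [mem_zeros] at hi ⊢
    by_contra hx
    exact hx ((hxy i hx).symm.trans hi)
  have heq : zeros y = zeros x := Finset.eq_of_subset_of_card_le hsub hd.le
  ext i : 1
  by_cases hx : x i = 0
  · have : i ∈ zeros y := heq ▸ mem_zeros.2 hx
    rw [hx, mem_zeros.1 this]
  · exact (hxy i hx).symm

lemma centre_mem_realize (y : Cube n) : (fun i => (y i : ℝ)) ∈ realize y := by
  intro i
  split_ifs with h
  · simp [h]
  · rfl

/-- Invariance of the point set passes to the cells because all boundary cells have dimension `k -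
1`, and the centre of a cell determines it among cells of that dimension. -/
lemma neg_mem_cellBoundary_of_boundary {k : ℕ} {v : Finset (Cube n)} (hv : ∀ x ∈ v, dim x = k)
    (h : ∀ p ∈ boundary v, -p ∈ boundary v) : ∀ y ∈ cellBoundary v, -y ∈ cellBoundary v := by
  have hd : ∀ y ∈ cellBoundary v, dim y + 1 = k := by
    intro y hy
    obtain ⟨x, hx, hf⟩ := exists_isFacet_of_mem_cellBoundary hy
    rw [← hv x hx]; exact hf.2
  intro y hy
  obtain ⟨x, hx, hxy⟩ := mem_support.1
    (h (fun i => (y i : ℝ)) (mem_support.2 ⟨y, hy, centre_mem_realize y⟩))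
  have e : (-fun i => (y i : ℝ)) = fun i => (((-y) i : SignType) : ℝ) := by
    ext i
    simp only [Pi.neg_apply]
    cases y i <;> simp
  rw [e] at hxy
  have := eq_of_centre_mem_realize hxy (by
    have h1 := hd x hx
    have h2 := hd y hy
    rw [dim_neg]
    omega)
  rwa [← this]

/-- A homeomorphism of unions of cubes preserving the boundary preserves disks. -/
lemma IsDisk.of_homeomorph {k : ℕ} {v v' : Finset (Cube n)} (hv : IsDisk k v)
    (e : support v ≃ₜ support v')
    (he : ∀ p, (e p : Fin n → ℝ) ∈ boundary v' ↔ (p : Fin n → ℝ) ∈ boundary v) : IsDisk k v' := by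
  obtain ⟨h, hh⟩ := hv
  exact ⟨h.trans e, fun p => (he _).trans (hh p)⟩

lemma IsDisk.image_neg {k : ℕ} {v : Finset (Cube n)} (hv : IsDisk k v) :
    IsDisk k (v.image fun x => -x) :=
  hv.of_homeomorph ((Homeomorph.neg (Fin n → ℝ)).subtype fun p => by
    rw [mem_support_image_neg]; simp) fun p => by
      rw [mem_boundary_image_neg]; simp

/-! ### Gluing, and pushing along a diagonal -/

/-- Two unions of closed sets with a common part are homeomorphic, if the other parts correspond
under maps fixing the points of the common part. -/
lemma exists_homeomorph_of_union {X : Type*} [TopologicalSpace X] {F A B : Set X}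
    (hF : IsClosed F) (hA : IsClosed A) (hB : IsClosed B) {f g : X → X} (hf : Continuous f)
    (hg : Continuous g) (hfA : ∀ p ∈ A, f p ∈ B) (hgB : ∀ p ∈ B, g p ∈ A)
    (hgf : ∀ p ∈ A, g (f p) = p) (hfg : ∀ p ∈ B, f (g p) = p)
    (hfF : ∀ p ∈ F, p ∈ A → f p = p) (hgF : ∀ p ∈ F, p ∈ B → g p = p) :
    ∃ e : (F ∪ A : Set X) ≃ₜ (F ∪ B : Set X),
      (∀ p : (F ∪ A : Set X), (p : X) ∈ F → (e p : X) = p) ∧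
        ∀ p : (F ∪ A : Set X), (p : X) ∈ A → (e p : X) = f p := by
  classical
  have key : ∀ {A B : Set X} {f g : X → X}, IsClosed A → Continuous f → (∀ p ∈ A, f p ∈ B) →
      (∀ p ∈ A, g (f p) = p) → (∀ p ∈ F, p ∈ A → f p = p) → (∀ p ∈ F, p ∈ B → g p = p) →
      ContinuousOn (fun p => if p ∈ A then f p else p) (F ∪ A) ∧
      ∀ p ∈ F ∪ A, (if p ∈ A then f p else p) ∈ F ∪ B ∧
        (if (if p ∈ A then f p else p) ∈ B then g (if p ∈ A then f p else p)
          else (if p ∈ A then f p else p)) = p := by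
    intro A B f g hA hf hfA hgf hfF hgF
    constructor
    · refine ContinuousOn.union_of_isClosed ?_ ?_ hF hA
      · refine continuousOn_id.congr fun p hp => ?_
        by_cases h : p ∈ A
        · simp [h, hfF p hp h]
        · simp [h]
      · exact hf.continuousOn.congr fun p hp => if_pos hp
    · intro p hp
      by_cases h : p ∈ A
      · simp only [if_pos h, if_pos (hfA p h)]
        exact ⟨Or.inr (hfA p h), hgf p h⟩
      · simp only [if_neg h]
        have hpF := hp.resolve_right h
        refine ⟨Or.inl hpF, ?_⟩
        split_ifs with hB
        · exact hgF p hpF hB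
        · rfl
  obtain ⟨c1, k1⟩ := key hA hf hfA hgf hfF hgF
  obtain ⟨c2, k2⟩ := key hB hg hgB hfg hgF hfF
  refine ⟨{ toFun := fun p => ⟨_, (k1 p p.2).1⟩
            invFun := fun p => ⟨_, (k2 p p.2).1⟩
            left_inv := fun p => Subtype.ext (k1 p p.2).2
            right_inv := fun p => Subtype.ext (k2 p p.2).2
            continuous_toFun := (continuousOn_iff_continuous_domRestrict.1 c1).subtype_mk _
            continuous_invFun := (continuousOn_iff_continuous_domRestrict.1 c2).subtype_mk _ }, ?_, ?_⟩
  · intro p hp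
    change (if (p : X) ∈ A then f p else p) = p
    split_ifs with h
    · exact hfF p hp h
    · rfl
  · intro p hp
    exact if_pos hp

/-- Pushing along the diagonal of the cube `z` out of the vertex `w`, until a facet not
containing `w` is met. -/
noncomputable def push {z : Cube n} (hz : (zeros z).Nonempty) (w : Cube n) (p : Fin n → ℝ) :
    Fin n → ℝ := fun i =>
  if z i = 0 then p i - (1 + (zeros z).inf' hz fun t => (w t : ℝ) * p t) * (w i : ℝ) else p i

lemma continuous_push {z : Cube n} (hz : (zeros z).Nonempty) (w : Cube n) :
    Continuous (push hz w) := by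
  refine continuous_pi fun i => ?_
  unfold push
  split_ifs
  · have : Continuous fun p : Fin n → ℝ => (zeros z).inf' hz fun t => (w t : ℝ) * p t :=
      Continuous.finset_inf'_apply hz fun t _ => continuous_const.mul (continuous_apply t)
    fun_prop
  · exact continuous_apply i

lemma cast_mul_self {a : SignType} (ha : a ≠ 0) : (a : ℝ) * a = 1 := by
  cases a <;> simp at ha ⊢

lemma cast_mul_bounds {a : SignType} (ha : a ≠ 0) {r : ℝ} :
    r ∈ Set.Icc (-1 : ℝ) 1 ↔ -1 ≤ (a : ℝ) * r ∧ (a : ℝ) * r ≤ 1 := by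
  cases a <;> simp at ha ⊢
  constructor <;> rintro ⟨h1, h2⟩ <;> constructor <;> linarith

lemma cast_mul_eq_one {a : SignType} (ha : a ≠ 0) {r : ℝ} : (a : ℝ) * r = 1 ↔ r = a := by
  cases a <;> simp at ha ⊢
  constructor <;> intro h <;> linarith

/-- In the coordinates `w i * p i` the star is the part of the cube `z` where the maximum is `1`,
and the opposite star the part where the minimum is `-1`. The push subtracts one constant from all
these coordinates. -/
lemma mem_support_vertexStar {z w : Cube n} (hw : ∀ t, z t = 0 → w t ≠ 0) {p : Fin n → ℝ} :
    p ∈ support (vertexStar z w) ↔ (∀ i, z i ≠ 0 → p i = z i) ∧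
      (∀ i, z i = 0 → -1 ≤ (w i : ℝ) * p i ∧ (w i : ℝ) * p i ≤ 1) ∧
      ∃ t, z t = 0 ∧ (w t : ℝ) * p t = 1 := by
  simp only [mem_support, mem_vertexStar]
  constructor
  · rintro ⟨_, ⟨t, ht, rfl⟩, hp⟩
    have hpt : p t = (w t : ℝ) := by
      have := hp t
      rwa [Function.update_self, if_neg (hw t ht)] at this
    refine ⟨fun i hi => ?_, fun i hi => ?_, t, ht, (cast_mul_eq_one (hw t ht)).2 hpt⟩
    · have := hp i
      rwa [Function.update_of_ne (by rintro rfl; exact hi ht), if_neg hi] at this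
    · by_cases hit : i = t
      · subst hit
        rw [hpt, cast_mul_self (hw _ ht)]; norm_num
      · have := hp i
        rw [Function.update_of_ne hit, if_pos hi] at this
        exact (cast_mul_bounds (hw i hi)).1 this
  · rintro ⟨h1, h2, t, ht, h3⟩
    refine ⟨_, ⟨t, ht, rfl⟩, fun i => ?_⟩
    by_cases hit : i = t
    · subst hit
      rw [Function.update_self, if_neg (hw _ ht)]
      exact (cast_mul_eq_one (hw _ ht)).1 h3
    · rw [Function.update_of_ne hit]
      split_ifs with hi
      · exact (cast_mul_bounds (hw i hi)).2 (h2 i hi)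
      · exact h1 i hi

lemma cast_neg_mul (a : SignType) (r : ℝ) : ((-a : SignType) : ℝ) * r = -((a : ℝ) * r) := by
  cases a <;> simp

lemma mem_support_vertexStar_neg {z w : Cube n} (hw : ∀ t, z t = 0 → w t ≠ 0) {p : Fin n → ℝ} :
    p ∈ support (vertexStar z (-w)) ↔ (∀ i, z i ≠ 0 → p i = z i) ∧
      (∀ i, z i = 0 → -1 ≤ (w i : ℝ) * p i ∧ (w i : ℝ) * p i ≤ 1) ∧
      ∃ t, z t = 0 ∧ (w t : ℝ) * p t = -1 := by
  rw [mem_support_vertexStar (vertexStar_neg_ne_zero hw)]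
  simp only [Pi.neg_apply, cast_neg_mul]
  refine and_congr_right fun _ => and_congr (forall_congr' fun i => forall_congr' fun _ => ?_)
    (exists_congr fun t => and_congr_right fun _ => neg_eq_iff_eq_neg)
  constructor <;> rintro ⟨h1, h2⟩ <;> constructor <;> linarith

lemma mul_push {z w : Cube n} (hz : (zeros z).Nonempty) (hw : ∀ t, z t = 0 → w t ≠ 0)
    (p : Fin n → ℝ) {i : Fin n} (hi : z i = 0) :
    (w i : ℝ) * push hz w p i =
      (w i : ℝ) * p i - (1 + (zeros z).inf' hz fun t => (w t : ℝ) * p t) := by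
  rw [push, if_pos hi, mul_sub, mul_left_comm, cast_mul_self (hw i hi), mul_one]

lemma push_mem {z w : Cube n} (hz : (zeros z).Nonempty) (hw : ∀ t, z t = 0 → w t ≠ 0)
    {p : Fin n → ℝ} (hp : p ∈ support (vertexStar z w)) :
    push hz w p ∈ support (vertexStar z (-w)) := by
  rw [mem_support_vertexStar_neg hw]
  obtain ⟨h1, h2, -⟩ := (mem_support_vertexStar hw).1 hp
  -- The coordinate that attains the minimum is the one that reaches `-1`.
  obtain ⟨s, hs, hsm⟩ := Finset.exists_mem_eq_inf' hz fun t => (w t : ℝ) * p t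
  rw [mem_zeros] at hs
  refine ⟨fun i hi => ?_, fun i hi => ?_, s, hs, ?_⟩
  · rw [push, if_neg hi, h1 i hi]
  · rw [mul_push hz hw p hi]
    have := Finset.inf'_le (fun t => (w t : ℝ) * p t) (mem_zeros.2 hi)
    have h3 := h2 i hi
    have h4 := h2 s hs
    constructor <;> linarith
  · rw [mul_push hz hw p hs]
    linarith

lemma push_push {z w : Cube n} (hz : (zeros z).Nonempty) (hw : ∀ t, z t = 0 → w t ≠ 0)
    {p : Fin n → ℝ} (hp : p ∈ support (vertexStar z w)) :
    push hz (-w) (push hz w p) = p := by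
  obtain ⟨h1, h2, t, ht, h3⟩ := (mem_support_vertexStar hw).1 hp
  -- The coordinate with value `1` becomes `-m`, where `m` is the old minimum. Seen from the
  -- opposite vertex, the minimum is therefore again `m`, and the return push has the same length.
  have hinf : ((zeros z).inf' hz fun t => (((-w) t : SignType) : ℝ) * push hz w p t)
      = (zeros z).inf' hz fun t => (w t : ℝ) * p t := by
    set m := (zeros z).inf' hz fun t => (w t : ℝ) * p t with hm
    refine le_antisymm ?_ (Finset.le_inf' _ _ fun i hi => ?_)
    · refine (Finset.inf'_le _ (mem_zeros.2 ht)).trans ?_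
      rw [Pi.neg_apply, cast_neg_mul, mul_push hz hw p ht]
      linarith
    · rw [mem_zeros] at hi
      rw [Pi.neg_apply, cast_neg_mul, mul_push hz hw p hi]
      have := (h2 i hi).2
      linarith
  ext i
  rw [push]
  split_ifs with hi
  · rw [hinf, push, if_pos hi, Pi.neg_apply, mul_comm _ ((-w i : SignType) : ℝ), cast_neg_mul]
    ring
  · rw [push, if_neg hi]

lemma push_eq_self {z w : Cube n} (hz : (zeros z).Nonempty) {p : Fin n → ℝ}
    (h : ∀ i, z i = 0 → -1 ≤ (w i : ℝ) * p i) {t : Fin n} (ht : z t = 0)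
    (hpt : (w t : ℝ) * p t = -1) : push hz w p = p := by
  have hinf : ((zeros z).inf' hz fun t => (w t : ℝ) * p t) = -1 := by
    refine le_antisymm ((Finset.inf'_le _ (mem_zeros.2 ht)).trans hpt.le) ?_
    exact Finset.le_inf' _ _ fun i hi => h i (mem_zeros.1 hi)
  ext i
  rw [push, hinf]
  split_ifs <;> ring

lemma apply_eq_of_mem_realize {c : Cube n} {p : Fin n → ℝ} (hp : p ∈ realize c) {t : Fin n}
    (ht : c t ≠ 0) : p t = c t := by
  have := hp t
  rwa [if_neg ht] at this

/-- A flip preserves disks. -/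
lemma IsDisk.flip {k : ℕ} {v : Finset (Cube n)} (hd : IsDisk k v) (hv : IsSection k v)
    (hneg : ∀ y ∈ cellBoundary v, -y ∈ cellBoundary v)
    {z w : Cube n} (hz : dim z = k + 1) (hw : ∀ t, z t = 0 → w t ≠ 0)
    (hA : vertexStar z w ⊆ v) : IsDisk k (flip v z w) := by
  have hne : (zeros z).Nonempty := Finset.card_pos.1 (by unfold dim at hz; omega)
  have hw' := vertexStar_neg_ne_zero hw
  -- The first value makes the push from `w` fix the points shared with the old star; the second
  -- makes the push from `-w` fix those shared with the new one.
  have hF : ∀ p ∈ support (v \ vertexStar z w),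
      (∃ t, z t = 0 ∧ (w t : ℝ) * p t = -1) ∧ ∃ t, z t = 0 ∧ (w t : ℝ) * p t = 1 := by
    intro p hp
    obtain ⟨c, hc, hpc⟩ := mem_support.1 hp
    rw [Finset.mem_sdiff] at hc
    obtain ⟨⟨t, ht, h1⟩, t', ht', h2⟩ :=
      hv.exists_sign_of_notMem_vertexStar hneg hz hw hA hc.1 hc.2
    refine ⟨⟨t, ht, ?_⟩, t', ht', ?_⟩
    · rw [apply_eq_of_mem_realize hpc (by rw [h1]; exact hw' t ht), h1, mul_comm, cast_neg_mul,
        cast_mul_self (hw t ht)]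
    · rw [apply_eq_of_mem_realize hpc (by rw [h2]; exact hw t' ht'), h2, cast_mul_self (hw t' ht')]
  have hfix : ∀ p ∈ support (vertexStar z w), (∃ t, z t = 0 ∧ (w t : ℝ) * p t = -1) →
      push hne w p = p := by
    rintro p hp ⟨t, ht, hpt⟩
    exact push_eq_self hne (fun i hi => (((mem_support_vertexStar hw).1 hp).2.1 i hi).1) ht hpt
  obtain ⟨e, he1, he2⟩ := exists_homeomorph_of_union
    (isClosed_support (v \ vertexStar z w)) (isClosed_support (vertexStar z w))
    (isClosed_support (vertexStar z (-w))) (continuous_push hne w) (continuous_push hne (-w))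
    (fun p hp => push_mem hne hw hp)
    (fun p hp => by simpa using push_mem hne hw' hp)
    (fun p hp => push_push hne hw hp)
    (fun p hp => by simpa using push_push hne hw' hp)
    (fun p hp hpA => hfix p hpA (hF p hp).1)
    (fun p hp hpB => by
      obtain ⟨t, ht, hpt⟩ := (hF p hp).2
      refine push_eq_self hne
        (fun i hi => (((mem_support_vertexStar hw').1 hpB).2.1 i hi).1) ht ?_
      rw [Pi.neg_apply, cast_neg_mul, hpt])
  have hs : support v = support (v \ vertexStar z w) ∪ support (vertexStar z w) := by
    rw [← support_union, Finset.sdiff_union_of_subset hA]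
  have hs' : support (CubePile.flip v z w)
      = support (v \ vertexStar z w) ∪ support (vertexStar z (-w)) := by
    rw [← support_union, CubePile.flip]
  have hbfix : ∀ q : (support (v \ vertexStar z w) ∪ support (vertexStar z w) : Set (Fin n → ℝ)),
      (q : Fin n → ℝ) ∈ boundary v → (e q : Fin n → ℝ) = q := by
    intro q hq
    obtain ⟨y, hy, hqy⟩ := mem_support.1 hq
    rcases mem_cellBoundary_cases hw hA hy with ⟨c, hc, hyc⟩ | ⟨x, hx, hyx, j, hj, hyj⟩
    · exact he1 q (mem_support.2 ⟨c, hc, realize_subset_of_isFacet hyc hqy⟩)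
    · have hqA : (q : Fin n → ℝ) ∈ support (vertexStar z w) :=
        mem_support.2 ⟨x, hx, realize_subset_of_isFacet hyx hqy⟩
      rw [he2 q hqA]
      refine hfix _ hqA ⟨j, hj, ?_⟩
      rw [apply_eq_of_mem_realize hqy (by rw [hyj]; exact hw' j hj), hyj, mul_comm, cast_neg_mul,
        cast_mul_self (hw j hj)]
  refine hd.of_homeomorph
    ((Homeomorph.setCongr hs).trans (e.trans (Homeomorph.setCongr hs'.symm))) fun p => ?_
  have hb : boundary (CubePile.flip v z w) = boundary v := by
    rw [boundary, cellBoundary_flip hv hw hA, boundary]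
  have hsub : boundary v ⊆ support v := by
    intro q hq
    obtain ⟨y, hy, hqy⟩ := mem_support.1 hq
    obtain ⟨x, hx, hyx⟩ := exists_isFacet_of_mem_cellBoundary hy
    exact mem_support.2 ⟨x, hx, realize_subset_of_isFacet hyx hqy⟩
  rw [hb]
  change (e ⟨p, hs ▸ p.2⟩ : Fin n → ℝ) ∈ boundary v ↔ _
  constructor
  · intro h
    -- The image point lies in the boundary, so `e` fixes it; injectivity identifies it with `p`.
    have hfix' := hbfix ⟨_, hs.le (hsub h)⟩ h
    have := e.injective (Subtype.ext hfix')
    have := congrArg Subtype.val this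
    simp only at this
    rwa [this] at h
  · intro h
    rw [hbfix ⟨p, hs ▸ p.2⟩ h]
    exact h

/-! ### Sweeps by successive flips -/

/-- The `k`-section `v` is a disk with antipodally invariant boundary. -/
structure IsDiskSection (k : ℕ) (v : Finset (Cube n)) : Prop where
  isSection : IsSection k v
  isDisk : IsDisk k v
  neg_mem : ∀ y ∈ cellBoundary v, -y ∈ cellBoundary v

lemma IsDiskSection.flip {k : ℕ} {v : Finset (Cube n)} (hv : IsDiskSection k v)
    {z w : Cube n} (hz : dim z = k + 1) (hw : ∀ t, z t = 0 → w t ≠ 0)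
    (hA : vertexStar z w ⊆ v) : IsDiskSection k (flip v z w) where
  isSection := hv.isSection.flip hw hA
  isDisk := hv.isDisk.flip hv.isSection hv.neg_mem hz hw hA
  neg_mem := by rw [cellBoundary_flip hv.isSection hw hA]; exact hv.neg_mem

/-- The set `A'` of `k`-cubes arises from `A` by flips through the `(k + 1)`-cubes of `C`, each of
which is used once. -/
inductive Sweep (k : ℕ) : Finset (Cube n) → Finset (Cube n) → Finset (Cube n) → Prop
  | refl (A) : Sweep k A ∅ A
  | step {A C D z w} : Sweep k A C (D ∪ vertexStar z w) → dim z = k + 1 →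
      (∀ t, z t = 0 → w t ≠ 0) → Disjoint D (vertexStar z w) → z ∉ C →
      Sweep k A (insert z C) (D ∪ vertexStar z (-w))

/-- This keeps the stars met during a sweep of `A ⊆ v` away from `v \ A`, whose cubes are parallel
to none of `A`. -/
lemma Sweep.image_zeros {k : ℕ} {A C A' : Finset (Cube n)} (h : Sweep k A C A') :
    A'.image zeros = A.image zeros := by
  induction h with
  | refl => rfl
  | step _ _ hw _ _ ih =>
    rw [← ih, Finset.image_union, Finset.image_union, image_zeros_vertexStar hw,
      image_zeros_vertexStar (vertexStar_neg_ne_zero hw)]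

/-- Sweeping preserves disk sections and their boundaries. -/
theorem IsDiskSection.sweep {k : ℕ} {v A C A' : Finset (Cube n)} (hv : IsDiskSection k v)
    (hA : A ⊆ v) (h : Sweep k A C A') :
    IsDiskSection k ((v \ A) ∪ A') ∧ cellBoundary ((v \ A) ∪ A') = cellBoundary v := by
  induction h with
  | refl => rw [Finset.sdiff_union_of_subset hA]; exact ⟨hv, rfl⟩
  | @step C D z w h hz hw hdis _ ih =>
    obtain ⟨ih1, ih2⟩ := ih
    have hst : vertexStar z w ⊆ (v \ A) ∪ (D ∪ vertexStar z w) :=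
      Finset.subset_union_right.trans Finset.subset_union_right
    have hd : Disjoint (v \ A) (vertexStar z w) := by
      rw [Finset.disjoint_left]
      intro c hc hc'
      rw [Finset.mem_sdiff] at hc
      have : zeros c ∈ A.image zeros := by
        rw [← h.image_zeros]
        exact Finset.mem_image_of_mem _ (Finset.mem_union_right _ hc')
      obtain ⟨a, ha, hac⟩ := Finset.mem_image.1 this
      exact hc.2 (hv.isSection.eq_of_zeros_eq (hA ha) hc.1 hac ▸ ha)
    have heq : CubePile.flip ((v \ A) ∪ (D ∪ vertexStar z w)) z w = (v \ A) ∪ (D ∪ vertexStar z (-w)) := by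
      rw [CubePile.flip, ← Finset.union_assoc, Finset.union_sdiff_right,
        Finset.sdiff_eq_self_of_disjoint (Finset.disjoint_union_left.2 ⟨hd, hdis⟩),
        Finset.union_assoc]
    rw [← heq]
    exact ⟨ih1.flip hz hw hst, (cellBoundary_flip ih1.isSection hw hst).trans ih2⟩

lemma Sweep.trans {k : ℕ} {A C A' C' A'' : Finset (Cube n)} (h : Sweep k A C A')
    (h' : Sweep k A' C' A'') (hC : Disjoint C C') : Sweep k A (C ∪ C') A'' := by
  induction h' with
  | refl => simpa using h
  | step _ hz hw hdis hzC ih =>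
    rw [Finset.disjoint_insert_right] at hC
    rw [Finset.union_insert]
    exact .step (ih hC.2) hz hw hdis (by simp [hC.1, hzC])

lemma vertexStar_congr {z w w' : Cube n} (h : ∀ t, z t = 0 → w t = w' t) :
    vertexStar z w = vertexStar z w' :=
  Finset.image_congr fun t ht => by
    change Function.update _ _ _ = Function.update _ _ _
    rw [h t (by simpa using ht)]

/-- A sweep is carried to a sweep by an injection compatible with the formation of stars. -/
lemma Sweep.map {m k : ℕ} {A C A' : Finset (Cube m)} (h : Sweep k A C A')
    {φ : Cube m → Cube n} (hφ : Function.Injective φ) (hdim : ∀ x, dim (φ x) = dim x)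
    (hstar : ∀ z w : Cube m, (∀ t, z t = 0 → w t ≠ 0) → ∃ w' : Cube n,
      (∀ t, φ z t = 0 → w' t ≠ 0) ∧ (vertexStar z w).image φ = vertexStar (φ z) w' ∧
      (vertexStar z (-w)).image φ = vertexStar (φ z) (-w'))
    {E : Finset (Cube n)} (hE : ∀ x, φ x ∉ E) :
    Sweep k (E ∪ A.image φ) (C.image φ) (E ∪ A'.image φ) := by
  induction h with
  | refl => rw [Finset.image_empty]; exact .refl _
  | @step C D z w _ hz hw hdis hzC ih =>
    obtain ⟨w', hw', h1, h2⟩ := hstar z w hw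
    rw [Finset.image_union, h1, ← Finset.union_assoc] at ih
    rw [Finset.image_union, h2, ← Finset.union_assoc, Finset.image_insert]
    refine .step ih ((hdim z).trans hz) hw' ?_ ?_
    · rw [← h1, Finset.disjoint_union_left]
      refine ⟨?_, (Finset.disjoint_image hφ).2 hdis⟩
      rw [Finset.disjoint_right]
      intro x hx
      obtain ⟨a, -, rfl⟩ := Finset.mem_image.1 hx
      exact hE a
    · rwa [hφ.mem_finset_image]

/-! ### Sweeps and the extension of words -/

lemma extend_last (s : SignType) (x : Cube n) : extend s x (Fin.last n) = s := by
  simp [extend]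

lemma extend_castSucc (s : SignType) (x : Cube n) (i : Fin n) :
    extend s x i.castSucc = x i := by
  simp [extend]

lemma extend_inj {s s' : SignType} {x x' : Cube n} :
    extend s x = extend s' x' ↔ s = s' ∧ x = x' := by
  constructor
  · intro h
    refine ⟨by simpa [extend_last] using congrFun h (Fin.last n), ?_⟩
    ext i : 1
    simpa [extend_castSucc] using congrFun h i.castSucc
  · rintro ⟨rfl, rfl⟩; rfl

lemma extend_injective (s : SignType) : Function.Injective (extend (n := n) s) :=
  fun _ _ h => (extend_inj.1 h).2

lemma extend_neg (s : SignType) (x : Cube n) : extend (-s) (-x) = -extend s x := by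
  ext i : 1
  refine Fin.lastCases ?_ (fun i => ?_) i
  · simp [extend_last]
  · simp [extend_castSucc]

lemma zeros_extend_of_ne {s : SignType} (hs : s ≠ 0) (x : Cube n) :
    zeros (extend s x) = (zeros x).map Fin.castSuccEmb := by
  ext i
  refine Fin.lastCases ?_ (fun i => ?_) i
  · simp [extend_last, hs]
  · simp [extend_castSucc]

lemma zeros_extend_zero (x : Cube n) :
    zeros (extend 0 x) = insert (Fin.last n) ((zeros x).map Fin.castSuccEmb) := by
  ext i
  refine Fin.lastCases ?_ (fun i => ?_) i
  · simp [extend_last]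
  · simp [extend_castSucc]

lemma dim_extend_of_ne {s : SignType} (hs : s ≠ 0) (x : Cube n) : dim (extend s x) = dim x := by
  rw [dim, zeros_extend_of_ne hs, Finset.card_map, dim]

lemma dim_extend_zero (x : Cube n) : dim (extend 0 x) = dim x + 1 := by
  rw [dim, zeros_extend_zero, Finset.card_insert_of_notMem (by simp), Finset.card_map, dim]

lemma update_extend_castSucc (s a : SignType) (x : Cube n) (i : Fin n) :
    Function.update (extend s x) i.castSucc a = extend s (Function.update x i a) := by
  rw [extend, extend, Fin.snoc_update]

lemma update_extend_last (s a : SignType) (x : Cube n) :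
    Function.update (extend s x) (Fin.last n) a = extend a x := by
  rw [extend, Fin.update_snoc_last, extend]

lemma image_extend_vertexStar {s : SignType} (hs : s ≠ 0) (z w : Cube n) (a : SignType) :
    (vertexStar z w).image (extend s) = vertexStar (extend s z) (extend a w) := by
  rw [vertexStar, vertexStar, zeros_extend_of_ne hs, Finset.map_eq_image, Finset.image_image,
    Finset.image_image]
  refine Finset.image_congr fun t _ => ?_
  simp [update_extend_castSucc, extend_castSucc]

/-- Besides the prisms over the star of `w`, the star upstairs contains the end `extend a z`. A flip
through the prism over `z` thus also carries `z` from one end to the other. -/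
lemma vertexStar_extend_zero (z w : Cube n) (a : SignType) :
    vertexStar (extend 0 z) (extend a w)
      = insert (extend a z) ((vertexStar z w).image (extend 0)) := by
  rw [vertexStar, vertexStar, zeros_extend_zero, Finset.image_insert, Finset.map_eq_image,
    Finset.image_image, Finset.image_image, extend_last, update_extend_last]
  congr 1
  refine Finset.image_congr fun t _ => ?_
  simp [update_extend_castSucc, extend_castSucc]

lemma Sweep.extend {k : ℕ} {A C A' : Finset (Cube n)} (h : Sweep k A C A') {s : SignType}
    (hs : s ≠ 0) {E : Finset (Cube (n + 1))} (hE : ∀ x, extend s x ∉ E) :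
    Sweep k (E ∪ A.image (extend s)) (C.image (extend s)) (E ∪ A'.image (extend s)) := by
  refine h.map (extend_injective s) (dim_extend_of_ne hs) (fun z w hw => ?_) hE
  refine ⟨CubePile.extend 1 w, ?_, image_extend_vertexStar hs z w 1, ?_⟩
  · intro t
    refine Fin.lastCases ?_ (fun t => ?_) t
    · simp [extend_last]
    · simpa [extend_castSucc] using hw t
  · rw [← extend_neg]; exact image_extend_vertexStar hs z (-w) _

/-- A sweep through cubes of `E` gives a sweep through their products with an interval. -/
lemma Sweep.prism {k : ℕ} {A C A' : Finset (Cube n)} (h : Sweep k A C A') {s : SignType}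
    (hs : s ≠ 0) {E : Finset (Cube n)} (hC : C ⊆ E) :
    Sweep (k + 1) (A.image (CubePile.extend 0) ∪ E.image (CubePile.extend s))
      (C.image (CubePile.extend 0))
      (A'.image (CubePile.extend 0) ∪ (E \ C).image (CubePile.extend s) ∪
        C.image (CubePile.extend (-s))) := by
  induction h with
  | refl => simpa using Sweep.refl _
  | @step C D z w _ hz hw hdis hzC ih =>
    rw [Finset.insert_subset_iff] at hC
    have ih := ih hC.2
    set D' := D.image (CubePile.extend 0) ∪ (E \ insert z C).image (CubePile.extend s) ∪
        C.image (CubePile.extend (-s)) with hD'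
    -- As `z` has not been used before, its copy at the end `s` is still in place. For this reason
    -- `Sweep` records the cubes used.
    have hEC : E \ C = insert z (E \ insert z C) := by
      ext x
      by_cases hx : x = z
      · subst hx; simp [hC.1, hzC]
      · simp [hx]
    have e1 : (D ∪ vertexStar z w).image (CubePile.extend 0) ∪ (E \ C).image (CubePile.extend s) ∪
        C.image (CubePile.extend (-s))
        = D' ∪ vertexStar (CubePile.extend 0 z) (CubePile.extend s w) := by
      rw [vertexStar_extend_zero, hD', hEC, Finset.image_union, Finset.image_insert]
      ext x
      simp only [Finset.mem_union, Finset.mem_insert]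
      tauto
    have e2 : (D ∪ vertexStar z (-w)).image (CubePile.extend 0) ∪
        (E \ insert z C).image (CubePile.extend s) ∪ (insert z C).image (CubePile.extend (-s))
        = D' ∪ vertexStar (CubePile.extend 0 z) (-CubePile.extend s w) := by
      rw [← extend_neg, vertexStar_extend_zero, hD', Finset.image_union, Finset.image_insert]
      ext x
      simp only [Finset.mem_union, Finset.mem_insert]
      tauto
    rw [e1] at ih
    rw [e2, Finset.image_insert]
    refine .step ih (by rw [dim_extend_zero, hz]) ?_ ?_ ?_
    · intro t
      refine Fin.lastCases ?_ (fun t => ?_) t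
      · simp [extend_last, hs]
      · simpa [extend_castSucc] using hw t
    · rw [vertexStar_extend_zero, Finset.disjoint_left]
      have hs' : s ≠ -s := sign_ne_neg_self hs
      have hs'' : -s ≠ 0 := sign_neg_ne_zero hs
      intro x hx hx'
      simp only [hD', Finset.mem_union, Finset.mem_insert, Finset.mem_image] at hx hx'
      rcases hx with (⟨a, ha, rfl⟩ | ⟨a, ha, rfl⟩) | ⟨a, ha, rfl⟩ <;>
        rcases hx' with hx' | ⟨b, hb, hx'⟩ <;> rw [extend_inj] at hx'
      · exact hs hx'.1.symm
      · exact (Finset.disjoint_left.1 hdis) ha (hx'.2 ▸ hb)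
      · simp [hx'.2] at ha
      · exact hs hx'.1.symm
      · exact hs' hx'.1.symm
      · exact hs'' hx'.1.symm
    · rwa [(extend_injective 0).mem_finset_image]

/-! ### Sweeping sources to targets -/

lemma sourceFaces_self (n : ℕ) : sourceFaces n n = {0} := by
  cases n <;> simp [sourceFaces]

lemma targetFaces_self (n : ℕ) : targetFaces n n = {0} := by
  cases n <;> simp [targetFaces]

lemma sourceFaces_zero (n : ℕ) : sourceFaces n 0 = {fun _ => -1} := by
  cases n
  · rw [sourceFaces]; congr 1; exact Subsingleton.elim _ _
  · rw [sourceFaces]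

lemma targetFaces_zero (n : ℕ) : targetFaces n 0 = {fun _ => 1} := by
  cases n
  · rw [targetFaces]; congr 1; exact Subsingleton.elim _ _
  · rw [targetFaces]

lemma extend_zero_zero : extend 0 (0 : Cube n) = 0 := by
  ext i : 1
  refine Fin.lastCases ?_ (fun i => ?_) i
  · simp [extend_last]
  · simp [extend_castSucc]

lemma extend_const (a : SignType) : extend a (fun _ : Fin n => a) = fun _ => a := by
  ext i : 1
  refine Fin.lastCases ?_ (fun i => ?_) i
  · simp [extend_last]
  · simp [extend_castSucc]

lemma sourceFaces_succ {n k : ℕ} (h : k < n) : sourceFaces (n + 1) (k + 1) =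
    (sourceFaces n k).image (extend 0) ∪
      (sourceFaces n (k + 1)).image (extend (if Even (k + 1) then -1 else 1)) := by
  rw [sourceFaces, if_neg (by omega)]
  split_ifs <;> rfl

lemma targetFaces_succ {n k : ℕ} (h : k < n) : targetFaces (n + 1) (k + 1) =
    (targetFaces n k).image (extend 0) ∪
      (targetFaces n (k + 1)).image (extend (if Even (k + 1) then 1 else -1)) := by
  rw [targetFaces, if_neg (by omega)]
  split_ifs <;> exact Finset.union_comm _ _

lemma disjoint_image_extend {s s' : SignType} (h : s ≠ s') (A B : Finset (Cube n)) :
    Disjoint (A.image (extend s)) (B.image (extend s')) := by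
  rw [Finset.disjoint_left]
  intro x hx hx'
  obtain ⟨a, -, rfl⟩ := Finset.mem_image.1 hx
  obtain ⟨b, -, e⟩ := Finset.mem_image.1 hx'
  exact h (extend_inj.1 e).1.symm

/-- The sources are swept to the targets through the sources of the next dimension. -/
theorem sweep_sourceFaces (n k : ℕ) (h : k < n) :
    Sweep k (sourceFaces n k) (sourceFaces n (k + 1)) (targetFaces n k) := by
  induction n generalizing k with
  | zero => omega
  | succ n ih =>
    -- First half of the sweep: prisms over the sweep from `ψ_{k-1}[n]` to `ω_{k-1}[n]` carry
    -- `ψ_k[n]` from the end `s` to the end `-s`. The set `E` is the part with last symbol `0`,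
    -- already in its target position; for `k = 0` it is empty and the sweep is a single edge.
    have hfirst : ∀ s : SignType, s = (if Even k then -1 else 1) → ∃ E : Finset (Cube (n + 1)),
        (∀ x, extend (-s) x ∉ E) ∧
        Sweep k (sourceFaces (n + 1) k) ((sourceFaces n k).image (extend 0))
          (E ∪ (sourceFaces n k).image (extend (-s))) ∧
        targetFaces (n + 1) k = E ∪ (targetFaces n k).image (extend (-s)) := by
      rintro s hs
      have hs0 : s ≠ 0 := by rw [hs]; split_ifs <;> decide
      cases k with
      | zero =>
        have hs : s = -1 := by simpa using hs
        subst hs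
        refine ⟨∅, by simp, ?_, ?_⟩
        · have hz : zeros (extend 0 fun _ : Fin n => (-1 : SignType)) = {Fin.last n} := by
            rw [zeros_extend_zero]
            have : zeros (fun _ : Fin n => (-1 : SignType)) = ∅ := by simp [zeros]
            rw [this]; rfl
          have hst : ∀ w : Cube (n + 1), vertexStar (extend 0 fun _ : Fin n => -1) w
              = {extend (w (Fin.last n)) fun _ => -1} := by
            intro w
            rw [vertexStar, hz, Finset.image_singleton, update_extend_last]
          have := Sweep.step (k := 0) (A := {fun _ => -1}) (C := ∅) (D := ∅)
            (z := extend 0 fun _ : Fin n => -1) (w := fun _ => -1)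
            (by rw [hst, extend_const, Finset.empty_union]; exact .refl _)
            (by rw [dim, hz, Finset.card_singleton]) (fun _ _ => by decide) (by simp) (by simp)
          rw [hst] at this
          rw [sourceFaces_zero, sourceFaces_zero, Finset.image_singleton, Finset.image_singleton]
          exact this
        · rw [targetFaces_zero, targetFaces_zero, Finset.image_singleton, neg_neg, extend_const,
            Finset.empty_union]
      | succ k =>
        refine ⟨(targetFaces n k).image (extend 0), ?_, ?_, ?_⟩
        · intro x hx
          obtain ⟨a, -, e⟩ := Finset.mem_image.1 hx
          exact sign_neg_ne_zero hs0 (extend_inj.1 e).1.symm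
        · have := (ih k (by omega)).prism hs0 (Finset.Subset.refl _)
          rw [sourceFaces_succ (by omega), ← hs]
          simpa using this
        · rw [targetFaces_succ (by omega), hs]
          split_ifs <;> rfl
    obtain ⟨E, hE, h1, h2⟩ := hfirst _ rfl
    -- For `k = n` the source and target at the end `-s` coincide and the first half suffices.
    -- Otherwise a sweep inside that end completes it.
    rcases (Nat.lt_succ_iff.1 h).eq_or_lt with rfl | hlt
    · rw [h2, targetFaces_self, sourceFaces_self]
      rw [sourceFaces_self] at h1
      simpa [extend_zero_zero] using h1
    · have hs0 : -(if Even k then -1 else 1 : SignType) ≠ 0 := by split_ifs <;> decide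
      have h3 := (ih k hlt).extend hs0 hE
      rw [← h2] at h3
      have h4 := h1.trans h3 (disjoint_image_extend hs0.symm _ _)
      rw [sourceFaces_succ hlt]
      -- The sign rule alternates with the parity of `k`, so `-s` is exactly the end at which
      -- `ψ_{k+1}[n+1]` contains `ψ_{k+1}[n]`.
      convert h4 using 4
      simp only [Nat.even_add_one]
      split_ifs <;> simp_all

/-! ### Transport into a sub-cube -/

/-- The position in `x` of the `t`-th symbol `0`. -/
def zeroPos (x : Cube n) : Fin (dim x) ↪ Fin n :=
  ((zeros x).orderEmbOfFin rfl).toEmbedding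

lemma apply_zeroPos (x : Cube n) (t : Fin (dim x)) : x (zeroPos x t) = 0 :=
  mem_zeros.1 ((zeros x).orderEmbOfFin_mem rfl t)

lemma place_zeroPos (x : Cube n) (y : Cube (dim x)) (t : Fin (dim x)) :
    place x y (zeroPos x t) = y t := by
  rw [place, dif_pos (apply_zeroPos x t)]
  congr 1
  exact ((zeros x).orderIsoOfFin rfl).symm_apply_apply t

lemma exists_zeroPos_eq {x : Cube n} {i : Fin n} (h : x i = 0) : ∃ t, zeroPos x t = i := by
  refine ⟨((zeros x).orderIsoOfFin rfl).symm ⟨i, mem_zeros.2 h⟩, ?_⟩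
  exact congrArg Subtype.val
    (((zeros x).orderIsoOfFin rfl).apply_symm_apply (⟨i, mem_zeros.2 h⟩ : zeros x))

lemma place_of_ne_zero {x : Cube n} (y : Cube (dim x)) {i : Fin n} (h : x i ≠ 0) :
    place x y i = x i := by
  rw [place, dif_neg h]

lemma place_injective (x : Cube n) : Function.Injective (place x) := by
  intro a b h
  ext t : 1
  rw [← place_zeroPos x a, h, place_zeroPos]

lemma zeros_place (x : Cube n) (y : Cube (dim x)) :
    zeros (place x y) = (zeros y).map (zeroPos x) := by
  ext i
  by_cases hi : x i = 0
  · obtain ⟨t, rfl⟩ := exists_zeroPos_eq hi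
    simp [place_zeroPos]
  · simp only [mem_zeros, place_of_ne_zero y hi, hi, Finset.mem_map, false_iff]
    rintro ⟨t, -, rfl⟩
    exact hi (apply_zeroPos x t)

lemma dim_place (x : Cube n) (y : Cube (dim x)) : dim (place x y) = dim y := by
  change (zeros _).card = (zeros _).card
  rw [zeros_place, Finset.card_map]

lemma place_update (x : Cube n) (y : Cube (dim x)) (t : Fin (dim x)) (a : SignType) :
    place x (Function.update y t a) = Function.update (place x y) (zeroPos x t) a := by
  ext i : 1
  by_cases hi : x i = 0
  · obtain ⟨t', rfl⟩ := exists_zeroPos_eq hi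
    rw [place_zeroPos]
    by_cases h : t' = t
    · subst h; simp
    · rw [Function.update_of_ne h, Function.update_of_ne ((zeroPos x).injective.ne h),
        place_zeroPos]
  · rw [Function.update_of_ne (by rintro rfl; exact hi (apply_zeroPos x t)),
      place_of_ne_zero _ hi, place_of_ne_zero _ hi]

lemma image_place_vertexStar (x : Cube n) (z w : Cube (dim x)) :
    (vertexStar z w).image (place x) = vertexStar (place x z) (place x w) := by
  rw [vertexStar, vertexStar, zeros_place, Finset.map_eq_image, Finset.image_image,
    Finset.image_image]
  refine Finset.image_congr fun t _ => ?_
  simp [place_update, place_zeroPos]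

lemma Sweep.place {k : ℕ} (x : Cube n) {A C A' : Finset (Cube (dim x))} (h : Sweep k A C A') :
    Sweep k (A.image (place x)) (C.image (place x)) (A'.image (place x)) := by
  have := h.map (place_injective x) (dim_place x) (E := ∅) (fun z w hw => ?_) (by simp)
  · simpa using this
  · have hz : ∀ i, CubePile.place x z i = 0 → ∃ t, zeroPos x t = i ∧ z t = 0 := by
      intro i hi
      rw [← mem_zeros, zeros_place, Finset.mem_map] at hi
      obtain ⟨t, ht, rfl⟩ := hi
      exact ⟨t, rfl, mem_zeros.1 ht⟩
    refine ⟨CubePile.place x w, ?_, image_place_vertexStar x z w, ?_⟩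
    · intro i hi
      obtain ⟨t, rfl, ht⟩ := hz i hi
      rw [place_zeroPos]; exact hw t ht
    · rw [image_place_vertexStar]
      refine vertexStar_congr fun i hi => ?_
      obtain ⟨t, rfl, -⟩ := hz i hi
      rw [Pi.neg_apply, place_zeroPos, place_zeroPos, Pi.neg_apply]

/-- Replacing the source faces of a cube by its target faces preserves disk sections
and their boundaries. -/
theorem IsDiskSection.source_to_target {k : ℕ} {v : Finset (Cube n)} (hv : IsDiskSection k v)
    {x : Cube n} (hk : k ≤ dim x) (hx : sourceOf x k ⊆ v) :
    IsDiskSection k ((v \ sourceOf x k) ∪ targetOf x k) ∧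
      cellBoundary ((v \ sourceOf x k) ∪ targetOf x k) = cellBoundary v := by
  rcases hk.eq_or_lt with rfl | hlt
  · have : targetOf x (dim x) = sourceOf x (dim x) := by
      rw [targetOf, sourceOf, targetFaces_self, sourceFaces_self]
    rw [this, Finset.sdiff_union_of_subset hx]
    exact ⟨hv, rfl⟩
  · exact hv.sweep hx ((sweep_sourceFaces _ k hlt).place x)

/-! ### The antipodal operation and the assembly -/

lemma IsSection.image_neg {k : ℕ} {v : Finset (Cube n)} (hv : IsSection k v) :
    IsSection k (v.image fun x => -x) := by
  refine ⟨fun x hx => ?_, fun S hS => ?_⟩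
  · rw [← dim_neg]; exact hv.1 _ (mem_image_neg.1 hx)
  · obtain ⟨x, ⟨hx, hxS⟩, huniq⟩ := hv.2 S hS
    refine ⟨-x, ⟨mem_image_neg.2 (by simpa using hx), by rw [zeros_neg, hxS]⟩, ?_⟩
    rintro y ⟨hy, hyS⟩
    exact neg_eq_iff_eq_neg.1 (huniq (-y) ⟨mem_image_neg.1 hy, by rw [zeros_neg, hyS]⟩)

lemma boundary_image_neg {v : Finset (Cube n)} (h : ∀ p ∈ boundary v, -p ∈ boundary v) :
    boundary (v.image fun x => -x) = boundary v := by
  ext p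
  rw [mem_boundary_image_neg]
  exact ⟨fun hp => by simpa using h _ hp, h p⟩

/-- The cardinalities and dimensions required of a pile are already forced by the section property.
-/
lemma isDiskPile_of_forall {v : CubeSeq n n} (h : ∀ k : Fin (n + 1),
    IsSection k (v k) ∧ IsDisk k (v k) ∧ ∀ p ∈ boundary (v k), -p ∈ boundary (v k)) :
    IsDiskPile v :=
  ⟨fun k => ⟨(h k).1.card_eq, (h k).1.1⟩, h⟩

end CubePile

theorem proposition4p10 (n : ℕ) (v : CubeSeq n n) (hv : IsDiskPile v) :
    (∀ j : ℕ, IsDiskPile (antipodeBelow j v) ∧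
      ∀ k : Fin (n + 1), boundary (antipodeBelow j v k) = boundary (v k)) ∧
    (∀ x : Cube n, MoveDefined x v → IsDiskPile (move x v) ∧
      ∀ k : Fin (n + 1), boundary (move x v k) = boundary (v k)) := by
  constructor
  · intro j
    have hb : ∀ k : Fin (n + 1), boundary (antipodeBelow j v k) = boundary (v k) := by
      intro k
      unfold antipodeBelow
      split_ifs
      · exact boundary_image_neg (hv.2 k).2.2
      · rfl
    refine ⟨isDiskPile_of_forall fun k => ?_, hb⟩
    rw [hb]
    refine ⟨?_, ?_, (hv.2 k).2.2⟩ <;> unfold antipodeBelow <;> split_ifs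
    · exact (hv.2 k).1.image_neg
    · exact (hv.2 k).1
    · exact (hv.2 k).2.1.image_neg
    · exact (hv.2 k).2.1
  · intro x hx
    have hds : ∀ k : Fin (n + 1), IsDiskSection k (v k) := fun k =>
      ⟨(hv.2 k).1, (hv.2 k).2.1, neg_mem_cellBoundary_of_boundary (hv.2 k).1.1 (hv.2 k).2.2⟩
    have key : ∀ k : Fin (n + 1), IsDiskSection k (move x v k) ∧
        cellBoundary (move x v k) = cellBoundary (v k) := by
      intro k
      unfold move
      split_ifs with hk
      · exact (hds k).source_to_target hk (hx k hk)
      · exact ⟨hds k, rfl⟩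
    have hb : ∀ k : Fin (n + 1), boundary (move x v k) = boundary (v k) := fun k => by
      rw [boundary, (key k).2, boundary]
    refine ⟨isDiskPile_of_forall fun k => ⟨(key k).1.isSection, (key k).1.isDisk, ?_⟩, hb⟩
    rw [hb]
    exact (hv.2 k).2.2
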